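/- Let $m\ge 1$, $A\in\mathbb C^{m\times m}$ and $z_0\in\mathbb C$. For $\varepsilon\ge 0$ let $\Lambda_\varepsilon(A)=\{z\in\mathbb C:\ z \text{ is an eigenvalue of } A+\Delta \text{ for some } \Delta\in\mathbb C^{m\times m} \text{ with } \|\Delta\|\le\varepsilon\}$ be the $\varepsilon$-pseudospectrum of $A$ ($\|\cdot\|$ the spectral norm), let $\mathcal R_{z_0}(\theta)=\{z_0+re^{\mathbf i\theta}: r>0\}$, let $\sigma_{\min}$ denote the smallest singular value, and let $f_A(r,\theta)=\sigma_{\min}(A-(z_0+re^{\mathbf i\theta})I)$. Put $$C=\begin{bmatrix}A-z_0I&-\varepsilon I\\ \varepsilon I&-(A-z_0I)^*\end{bmatrix},\qquad D_\theta=\begin{bmatrix}-\mathbf i e^{\mathbf i\theta}I&0\\0&\mathbf i e^{-\mathbf i\theta}I\end{bmatrix},$$ and let $\Lambda(C,D_\theta)=\{\lambda\in\mathbb C:\det(C-\lambda D_\theta)=0\}$ be the spectrum of the pencil $(C,D_\theta)$; an eigenvalue $\lambda_0\in\Lambda(C,D_\theta)$ is simple if it is a simple root of $\lambda\mapsto\det(C-\lambda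 D_\theta)$. For $\theta\in\mathbb R$ define $$a_\varepsilon(\theta)=\min\{\operatorname{Arg}(-\mathbf i\lambda)^2:\ \lambda\in\Lambda(C,D_\theta),\ \operatorname{Re}\lambda\le 0\},\qquad \mathcal A(\varepsilon)=\{\theta\in(-\pi,\pi]:a_\varepsilon(\theta)=0\},$$ where $\operatorname{Arg}:\mathbb C\setminus\{0\}\to(-\pi,\pi]$ is the principal argument, and let $\mu$ be Lebesgue measure on $\mathbb R$. Let $\varepsilon\ge0$ not be a singular value of $A-z_0I$. Then $0\notin\Lambda(C,D_\theta)$ and the minimum defining $a_\varepsilon(\theta)$ exists for every $\theta\in\mathbb R$, and: (i) $a_\varepsilon(\theta)\ge 0$ for all $\theta$. (ii) For all $\theta$: $a_\varepsilon(\theta)=0$ $\Leftrightarrow$ there is $r>0$ with $\mathbf i r\in\Lambda(C,D_\theta)$ $\Leftrightarrow$ $\mathcal R_{z_0}(\theta)\cap\Lambda_\varepsilon(A)\ne\varnothing$. (iii) $a_\varepsilon$ is continuous on $\mathbb R$, in particular on $(-\pi,\pi]$. (iv) $a_\varepsilon$ is differentiable at $\theta$ whenever the eigenvalue $\lambda\in\Lambda(C,D_\theta)$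 with $\operatorname{Re}\lambda\le0$ attaining the value $a_\varepsilon(\theta)$ is unique and simple. (v) $\varepsilon=0\Leftrightarrow\mu(\mathcal A(\varepsilon))=0$. (vi) Let $\varepsilon_1,\varepsilon_2\ge 0$ not be singular values of $A-z_0I$. If $\varepsilon_1\le\varepsilon_2$, then $\mu(\mathcal A(\varepsilon_1))\le\mu(\mathcal A(\varepsilon_2))$. If some ray $\mathcal R_{z_0}(\theta)$ does not meet $\Lambda_{\varepsilon_1}(A)$, then $\varepsilon_1<\varepsilon_2\Leftrightarrow\mu(\mathcal A(\varepsilon_1))<\mu(\mathcal A(\varepsilon_2))$. (vii) If $\varepsilon>f_A(0,\theta)$ for some $\theta\in\mathbb R$ (the value $f_A(0,\theta)=\sigma_{\min}(A-z_0I)$ does not depend on $\theta$), then $\mu(\mathcal A(\varepsilon))=2\pi$. (viii) Regarded as a set of angles modulo $2\pi$, i.e. as a subset of the circle $\mathbb R/2\pi\mathbb Z$, $\mathcal A(\varepsilon)$ has at most $m$ connected components. If $\pi\notin\mathcal A(\varepsilon)$, then also $\mathcal A(\varepsilon)$ as a subset of $\mathbb R$ has at most $m$ connected components. -/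

import Mathlib

noncomputable section

namespace SepLambda

/-- The set of (all `m`) singular values of a square complex matrix. -/
def singularValueSet {m : ℕ} (M : Matrix (Fin m) (Fin m) ℂ) : Set ℝ :=
  {s | ∃ i : Fin m, (Matrix.toEuclideanLin M).singularValues i = s}

/-- The smallest singular value of an `m × m` matrix; Mathlib lists the singular values in
descending order starting from index `0`, so it is the one of index `m - 1` (for `m ≥ 1`). -/
def sigmaMin {m : ℕ} (M : Matrix (Fin m) (Fin m) ℂ) : ℝ :=
  (Matrix.toEuclideanLin M).singularValues (m - 1)

/-- The `ε`-pseudospectrum of `A`: all eigenvalues of all perturbations `A + Δ` whose spectral norm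
`‖Δ‖` is at most `ε`. -/
def pseudospectrum {m : ℕ} (ε : ℝ) (A : Matrix (Fin m) (Fin m) ℂ) : Set ℂ :=
  {z | ∃ Δ : Matrix (Fin m) (Fin m) ℂ,
    ‖Matrix.toEuclideanCLM (n := Fin m) (𝕜 := ℂ) Δ‖ ≤ ε ∧ z ∈ spectrum ℂ (A + Δ)}

/-- The open ray emanating from `z₀` with angle `θ`. -/
def ray (z₀ : ℂ) (θ : ℝ) : Set ℂ :=
  {z | ∃ r : ℝ, 0 < r ∧ z = z₀ + (r : ℂ) * Complex.exp (Complex.I * θ)}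

/-- `F_A(r, θ) = A - (z₀ + r e^{iθ}) I`. -/
def rayShift {m : ℕ} (A : Matrix (Fin m) (Fin m) ℂ) (z₀ : ℂ) (r θ : ℝ) :
    Matrix (Fin m) (Fin m) ℂ :=
  A - (z₀ + (r : ℂ) * Complex.exp (Complex.I * θ)) • (1 : Matrix (Fin m) (Fin m) ℂ)

/-- `f_A(r, θ)`, the smallest singular value of `F_A(r, θ)`. -/
def rayFun {m : ℕ} (A : Matrix (Fin m) (Fin m) ℂ) (z₀ : ℂ) (r θ : ℝ) : ℝ :=
  sigmaMin (rayShift A z₀ r θ)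

/-- The characteristic polynomial `det (P - X Q)` of the matrix pencil `(P, Q)`. -/
def pencilPoly {n : Type*} [Fintype n] [DecidableEq n] (P Q : Matrix n n ℂ) : Polynomial ℂ :=
  (P.map (Polynomial.C : ℂ → Polynomial ℂ) -
    (Polynomial.X : Polynomial ℂ) • Q.map (Polynomial.C : ℂ → Polynomial ℂ)).det

/-- The spectrum of the matrix pencil `P - l Q`. -/
def pencilSpectrum {n : Type*} [Fintype n] [DecidableEq n] (P Q : Matrix n n ℂ) : Set ℂ :=
  {l | (P - l • Q).det = 0}

/-- `l` is a simple eigenvalue of the pencil `(P, Q)` (algebraic multiplicity one). -/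
def IsSimplePencilEigenvalue {n : Type*} [Fintype n] [DecidableEq n] (P Q : Matrix n n ℂ)
    (l : ℂ) : Prop :=
  (pencilPoly P Q).rootMultiplicity l = 1

/-- The matrix `C = [A - z₀ I, -ε I; ε I, -(A - z₀ I)^*]`. -/
def matC {m : ℕ} (A : Matrix (Fin m) (Fin m) ℂ) (z₀ : ℂ) (ε : ℝ) :
    Matrix (Fin m ⊕ Fin m) (Fin m ⊕ Fin m) ℂ :=
  Matrix.fromBlocks
    (A - z₀ • (1 : Matrix (Fin m) (Fin m) ℂ))
    (-((ε : ℂ) • (1 : Matrix (Fin m) (Fin m) ℂ)))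
    ((ε : ℂ) • (1 : Matrix (Fin m) (Fin m) ℂ))
    (-(A - z₀ • (1 : Matrix (Fin m) (Fin m) ℂ)).conjTranspose)

/-- The matrix `D_θ = [-i e^{iθ} I, 0; 0, i e^{-iθ} I]`. -/
def matD (m : ℕ) (θ : ℝ) : Matrix (Fin m ⊕ Fin m) (Fin m ⊕ Fin m) ℂ :=
  Matrix.fromBlocks
    ((-Complex.I * Complex.exp (Complex.I * θ)) • (1 : Matrix (Fin m) (Fin m) ℂ))
    0
    0
    ((Complex.I * Complex.exp (-(Complex.I * θ))) • (1 : Matrix (Fin m) (Fin m) ℂ))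

/-- The eigenvalues of `(C, D_θ)` in the closed left half-plane. -/
def leftEigenvalues {m : ℕ} (A : Matrix (Fin m) (Fin m) ℂ) (z₀ : ℂ) (ε θ : ℝ) : Set ℂ :=
  {l | l ∈ pencilSpectrum (matC A z₀ ε) (matD m θ) ∧ l.re ≤ 0}

/-- `Arg(-i l)²`. -/
def sqArg (l : ℂ) : ℝ := (Complex.arg (-Complex.I * l)) ^ 2

/-- `a_ε(θ)`, the minimum of `Arg(-i l)²` over the eigenvalues `l` of `(C, D_θ)` with `Re l ≤ 0`.
The formula is used for every real angle; it is `2π`-periodic in `θ`. -/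
def aFun {m : ℕ} (A : Matrix (Fin m) (Fin m) ℂ) (z₀ : ℂ) (ε θ : ℝ) : ℝ :=
  sInf (sqArg '' leftEigenvalues A z₀ ε θ)

/-- The zero set of `a_ε` in `(-π, π]`. -/
def zeroSet {m : ℕ} (A : Matrix (Fin m) (Fin m) ℂ) (z₀ : ℂ) (ε : ℝ) : Set ℝ :=
  {θ | θ ∈ Set.Ioc (-Real.pi) Real.pi ∧ aFun A z₀ ε θ = 0}

/-- The zero set of `a_ε` as a set of angles modulo `2π`, a subset of the circle. -/
def zeroAngles {m : ℕ} (A : Matrix (Fin m) (Fin m) ℂ) (z₀ : ℂ) (ε : ℝ) : Set Real.Angle :=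
  (fun θ : ℝ => (θ : Real.Angle)) '' zeroSet A z₀ ε

end SepLambda

end

noncomputable section

namespace SepLambda

open Matrix Filter Topology MeasureTheory

variable {m : ℕ}

/-! At `λ = i r` with `r` real, `C - λ D_θ` is the block matrix built from `F = A - (z₀ + r
e^{iθ})`, and it is singular exactly when `ε` is a singular value of `F`. A ray that meets `Λ_ε(A)`
has a last point in it, and there `σ_min(F) = ε`. Hence positive imaginary eigenvalues detect rays
that meet the pseudospectrum (`exists_pencil_iff_ray`), and taking `r = 0` excludes the eigenvalue
`0`.

Since `D_θ` is invertible, the pencil is a standard eigenvalue problem whose monic characteristic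
polynomial depends continuously on `θ`. Its spectrum is symmetric under `λ ↦ -conj λ`, which
preserves `sqArg`, so the half-plane restriction does not affect the minimum. Persistence and local
boundedness of eigenvalues give continuity (`continuous_aFun`). The implicit function theorem gives
a differentiable branch at a simple eigenvalue, and the symmetry settles the case of a branch
starting on the imaginary axis (`differentiableAt_aFun`).

For the measure statements, the meeting angles form a closed periodic set. A boundary angle for `ε₁`
is interior for every `ε₂ > ε₁`, so the measure grows strictly. For the component count, the maximum
principle for the resolvent puts an eigenvalue in every component of `Λ_ε(A)`, and the argument map
carries the components of `Λ_ε(A)` onto those of the angle set. -/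

/-! ### Singular values as eigenvalues and as minima -/

/-- The operator on Euclidean space given by a square matrix. -/
abbrev op (M : Matrix (Fin m) (Fin m) ℂ) :
    EuclideanSpace ℂ (Fin m) →L[ℂ] EuclideanSpace ℂ (Fin m) :=
  Matrix.toEuclideanCLM (n := Fin m) (𝕜 := ℂ) M

lemma op_conjTranspose (M : Matrix (Fin m) (Fin m) ℂ) :
    op Mᴴ = ContinuousLinearMap.adjoint (op M) := by
  rw [← ContinuousLinearMap.star_eq_adjoint, op, op, ← map_star, Matrix.star_eq_conjTranspose]

lemma op_sub_smul_one_apply (M : Matrix (Fin m) (Fin m) ℂ) (z : ℂ)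
    (v : EuclideanSpace ℂ (Fin m)) :
    op (M - z • (1 : Matrix (Fin m) (Fin m) ℂ)) v = op M v - z • v := by
  simp [op, map_sub, map_smul, map_one]

lemma inner_op_conjTranspose (M : Matrix (Fin m) (Fin m) ℂ) (v w : EuclideanSpace ℂ (Fin m)) :
    inner ℂ v (op Mᴴ w) = inner ℂ (op M v) w := by
  rw [op_conjTranspose, ContinuousLinearMap.adjoint_inner_right]

/-- Singular values are the nonnegative square roots of the eigenvalues of `Mᴴ M`; the sign
condition on `ε` selects the root. -/
lemma mem_singularValueSet_iff {M : Matrix (Fin m) (Fin m) ℂ} {ε : ℝ} (hε : 0 ≤ ε) :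
    ε ∈ singularValueSet M ↔
      ∃ v : EuclideanSpace ℂ (Fin m), v ≠ 0 ∧ op Mᴴ (op M v) = ((ε : ℂ) ^ 2) • v := by
  set T := Matrix.toEuclideanLin M with hT
  have key : ∀ v, op Mᴴ (op M v) = (LinearMap.adjoint T ∘ₗ T) v := by
    intro v
    rw [hT, ← Matrix.toEuclideanLin_conjTranspose_eq_adjoint]
    rfl
  have hfin : Module.finrank ℂ (EuclideanSpace ℂ (Fin m)) = m := by simp
  constructor
  · rintro ⟨i, hi⟩
    have h := T.hasEigenvalue_adjoint_comp_self_sq_singularValues (n := i) (by rw [hfin]; exact i.2)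
    obtain ⟨v, hv⟩ := h.exists_hasEigenvector
    refine ⟨v, hv.2, ?_⟩
    rw [key, hv.apply_eq_smul, hi]
    simp
  · rintro ⟨v, hv, h⟩
    have h2 : Module.End.HasEigenvalue (LinearMap.adjoint T ∘ₗ T) ((ε : ℂ) ^ 2) :=
      Module.End.hasEigenvalue_of_hasEigenvector
        ((Module.End.hasEigenvector_iff).2 ⟨Module.End.mem_eigenspace_iff.2 (by rw [← key, h]), hv⟩)
    obtain ⟨i, hi⟩ := T.isSymmetric_adjoint_comp_self.exists_eigenvalues_eq hfin h2
    refine ⟨i, ?_⟩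
    have h3 := T.sq_singularValues_fin hfin i
    have h4 : T.singularValues i ^ 2 = ε ^ 2 := by
      rw [h3]
      exact RCLike.ofReal_injective (K := ℂ) (hi.trans (by push_cast; rfl))
    exact (sq_eq_sq₀ (T.singularValues_nonneg i) hε).1 h4

lemma norm_op_sq (M : Matrix (Fin m) (Fin m) ℂ) (v : EuclideanSpace ℂ (Fin m)) :
    ‖op M v‖ ^ 2 = RCLike.re (inner ℂ v (op Mᴴ (op M v))) := by
  rw [inner_op_conjTranspose, inner_self_eq_norm_sq_to_K]
  norm_cast

/-- A right singular vector realises its singular value. -/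
lemma norm_op_eq_of_sq {M : Matrix (Fin m) (Fin m) ℂ} {ε : ℝ} (hε : 0 ≤ ε)
    {v : EuclideanSpace ℂ (Fin m)} (h : op Mᴴ (op M v) = ((ε : ℂ) ^ 2) • v) :
    ‖op M v‖ = ε * ‖v‖ := by
  have h1 : ‖op M v‖ ^ 2 = (ε * ‖v‖) ^ 2 := by
    rw [norm_op_sq, h, inner_smul_right, inner_self_eq_norm_sq_to_K, mul_pow]
    have h2 : (ε : ℂ) ^ 2 * ((‖v‖ : ℝ) : ℂ) ^ 2 = ((ε ^ 2 * ‖v‖ ^ 2 : ℝ) : ℂ) := by push_cast; rfl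
    exact (congrArg Complex.re h2).trans (Complex.ofReal_re _)
  exact (sq_eq_sq₀ (norm_nonneg _) (by positivity)).1 h1

lemma exists_unit_norm_op_eq {M : Matrix (Fin m) (Fin m) ℂ} {ε : ℝ} (hε : 0 ≤ ε)
    (h : ε ∈ singularValueSet M) : ∃ v : EuclideanSpace ℂ (Fin m), ‖v‖ = 1 ∧ ‖op M v‖ = ε := by
  obtain ⟨v, hv, h⟩ := (mem_singularValueSet_iff hε).1 h
  have hv' : ‖v‖ ≠ 0 := norm_ne_zero_iff.2 hv
  refine ⟨((‖v‖⁻¹ : ℝ) : ℂ) • v, ?_, ?_⟩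
  · rw [norm_smul, Complex.norm_real, norm_inv, norm_norm, inv_mul_cancel₀ hv']
  · rw [map_smul, norm_smul, norm_op_eq_of_sq hε h, Complex.norm_real, norm_inv, norm_norm]
    field_simp

lemma sigmaMin_mem_singularValueSet (hm : 0 < m) (M : Matrix (Fin m) (Fin m) ℂ) :
    sigmaMin M ∈ singularValueSet M :=
  ⟨⟨m - 1, by omega⟩, rfl⟩

lemma sigmaMin_nonneg (M : Matrix (Fin m) (Fin m) ℂ) : 0 ≤ sigmaMin M :=
  LinearMap.singularValues_nonneg _ _

/-- If `ε` is the minimum of `‖M v‖` over unit vectors, then `ε` is a singular value of `M`. -/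
lemma mem_singularValueSet_of_isMin {M : Matrix (Fin m) (Fin m) ℂ} {ε : ℝ} (hε : 0 ≤ ε)
    {v : EuclideanSpace ℂ (Fin m)} (hv : ‖v‖ = 1) (hvε : ‖op M v‖ ≤ ε)
    (hmin : ∀ w : EuclideanSpace ℂ (Fin m), ‖w‖ = 1 → ε ≤ ‖op M w‖) :
    ε ∈ singularValueSet M := by
  refine (mem_singularValueSet_iff hε).2 ⟨v, fun h => by simp [h] at hv, ?_⟩
  have hve : ‖op M v‖ = ε := le_antisymm hvε (hmin v hv)
  set S : EuclideanSpace ℂ (Fin m) →L[ℂ] EuclideanSpace ℂ (Fin m) := op Mᴴ ∘L op M with hS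
  have hsa : IsSelfAdjoint S := by
    rw [hS, op_conjTranspose, ← ContinuousLinearMap.star_eq_adjoint]
    exact IsSelfAdjoint.star_mul_self (op M)
  have hre : ∀ w, S.reApplyInnerSelf w = ‖op M w‖ ^ 2 := by
    intro w
    rw [ContinuousLinearMap.reApplyInnerSelf_apply, norm_op_sq, inner_re_symm]
    rfl
  -- A minimiser of the quadratic form of the self-adjoint `Mᴴ M` on the sphere is an eigenvector,
  -- with the Rayleigh quotient `ε ^ 2` as eigenvalue.
  have hext : IsMinOn S.reApplyInnerSelf (Metric.sphere 0 ‖v‖) v := by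
    intro w hw
    rw [mem_sphere_zero_iff_norm, hv] at hw
    simp only [Set.mem_ofPred_eq, hre, hve]
    exact pow_le_pow_left₀ hε (hmin w hw) 2
  have := hsa.eq_smul_self_of_isLocalExtrOn (Or.inl hext.localize)
  rw [ContinuousLinearMap.rayleighQuotient, hre, hv, hve] at this
  have h2 : S v = ((ε : ℂ) ^ 2) • v := by simpa using this
  exact h2

/-! ### The pencil on the imaginary axis -/

/-- The pencil matrix at a point of the imaginary axis is singular exactly at singular values. -/
lemma det_fromBlocks_eq_zero_iff (F : Matrix (Fin m) (Fin m) ℂ) {ε : ℝ} (hε : 0 ≤ ε) :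
    (Matrix.fromBlocks F (-((ε : ℂ) • (1 : Matrix (Fin m) (Fin m) ℂ)))
      ((ε : ℂ) • (1 : Matrix (Fin m) (Fin m) ℂ)) (-Fᴴ)).det = 0 ↔ ε ∈ singularValueSet F := by
  rw [← Matrix.exists_mulVec_eq_zero_iff, mem_singularValueSet_iff hε]
  have key : ∀ x y : Fin m → ℂ, (Matrix.fromBlocks F (-((ε : ℂ) • (1 : Matrix (Fin m) (Fin m) ℂ)))
      ((ε : ℂ) • (1 : Matrix (Fin m) (Fin m) ℂ)) (-Fᴴ)) *ᵥ Sum.elim x y = 0 ↔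
      F *ᵥ x = (ε : ℂ) • y ∧ Fᴴ *ᵥ y = (ε : ℂ) • x := by
    intro x y
    rw [Matrix.fromBlocks_mulVec, ← Sum.elim_zero_zero, Sum.elim_eq_iff]
    simp only [Sum.elim_comp_inl, Sum.elim_comp_inr, Matrix.neg_mulVec, Matrix.smul_mulVec,
      Matrix.one_mulVec]
    rw [← sub_eq_add_neg, ← sub_eq_add_neg, sub_eq_zero, sub_eq_zero, eq_comm (a := (ε : ℂ) • x)]
  constructor
  · rintro ⟨v, hv, h⟩
    obtain ⟨x, y, rfl⟩ : ∃ x y, v = Sum.elim x y := ⟨_, _, (Sum.elim_comp_inl_inr v).symm⟩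
    obtain ⟨h1, h2⟩ := (key x y).1 h
    -- The two block equations give `Fᴴ F x = ε² x`, so `x` is the required vector unless it
    -- vanishes. It vanishes only for `ε = 0`; then `y` is in the kernel of `Fᴴ`, and determinants
    -- yield a kernel vector of `F`.
    by_cases hx : x = 0
    · subst hx
      have hy : y ≠ 0 := by
        rintro rfl
        exact hv (Sum.elim_zero_zero)
      have hε0 : (ε : ℂ) = 0 := by
        rw [Matrix.mulVec_zero] at h1
        exact (smul_eq_zero.1 h1.symm).resolve_right hy
      have hdet : Fᴴ.det = 0 :=
        Matrix.exists_mulVec_eq_zero_iff.1 ⟨y, hy, by rw [h2, smul_zero]⟩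
      rw [Matrix.det_conjTranspose, star_eq_zero] at hdet
      obtain ⟨w, hw, hFw⟩ := Matrix.exists_mulVec_eq_zero_iff.2 hdet
      refine ⟨WithLp.toLp 2 w, by simpa using hw, ?_⟩
      have hz : op F (WithLp.toLp 2 w) = 0 := by
        rw [op, Matrix.toEuclideanCLM_toLp, hFw]; rfl
      rw [hz, hε0]
      simp
    · refine ⟨WithLp.toLp 2 x, by simpa using hx, ?_⟩
      rw [op, op, Matrix.toEuclideanCLM_toLp, Matrix.toEuclideanCLM_toLp, h1, Matrix.mulVec_smul, h2,
        smul_smul, ← sq]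
      rfl
  · rintro ⟨v, hv, h⟩
    have hv' : WithLp.ofLp v ≠ 0 := by simpa using hv
    have h' : Fᴴ *ᵥ (F *ᵥ WithLp.ofLp v) = ((ε : ℂ) ^ 2) • WithLp.ofLp v := by
      have := congrArg WithLp.ofLp h
      simpa using this
    -- The natural second block `ε⁻¹ F v` needs `ε ≠ 0`; for `ε = 0` one has `F v = 0`, and the
    -- second block can be `0`.
    by_cases h0 : (ε : ℂ) = 0
    · have hn := norm_op_eq_of_sq hε h
      have hε0 : ε = 0 := by exact_mod_cast h0
      rw [hε0, zero_mul, norm_eq_zero] at hn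
      refine ⟨Sum.elim (WithLp.ofLp v) 0, ?_, (key _ _).2 ⟨?_, ?_⟩⟩
      · intro h
        exact hv' (by simpa using congrArg (· ∘ Sum.inl) h)
      · have := congrArg WithLp.ofLp hn
        simpa using this
      · simp [h0]
    · refine ⟨Sum.elim (WithLp.ofLp v) ((ε : ℂ)⁻¹ • (F *ᵥ WithLp.ofLp v)), ?_,
        (key _ _).2 ⟨?_, ?_⟩⟩
      · intro h
        exact hv' (by simpa using congrArg (· ∘ Sum.inl) h)
      · rw [smul_smul, mul_inv_cancel₀ h0, one_smul]
      · rw [Matrix.mulVec_smul, h', smul_smul]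
        congr 1
        field_simp

lemma conj_exp_I_mul (θ : ℝ) :
    star (Complex.exp (Complex.I * θ)) = Complex.exp (-(Complex.I * θ)) := by
  rw [Complex.star_def, ← Complex.exp_conj]
  simp

/-- The factors in `D_θ` are chosen so that `i r` times them is `r e^{iθ}` and `-r e^{-iθ}`. As `r`
is real, the diagonal blocks become `F` and `-Fᴴ` for the same shifted matrix `F`. -/
lemma I_mul_mem_pencilSpectrum_iff (A : Matrix (Fin m) (Fin m) ℂ) (z₀ : ℂ) {ε : ℝ} (hε : 0 ≤ ε)
    (θ r : ℝ) : Complex.I * (r : ℂ) ∈ pencilSpectrum (matC A z₀ ε) (matD m θ) ↔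
      ε ∈ singularValueSet (rayShift A z₀ r θ) := by
  rw [← det_fromBlocks_eq_zero_iff _ hε, pencilSpectrum, Set.mem_ofPred_eq]
  have : matC A z₀ ε - (Complex.I * (r : ℂ)) • matD m θ =
      Matrix.fromBlocks (rayShift A z₀ r θ) (-((ε : ℂ) • (1 : Matrix (Fin m) (Fin m) ℂ)))
        ((ε : ℂ) • (1 : Matrix (Fin m) (Fin m) ℂ)) (-(rayShift A z₀ r θ)ᴴ) := by
    rw [matC, matD, Matrix.fromBlocks_smul, sub_eq_add_neg, Matrix.fromBlocks_neg,
      Matrix.fromBlocks_add, Matrix.fromBlocks_inj]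
    refine ⟨?_, by simp, by simp, ?_⟩
    · have : Complex.I * (r : ℂ) * (-Complex.I * Complex.exp (Complex.I * θ)) =
          r * Complex.exp (Complex.I * θ) := by
        linear_combination (-(r : ℂ) * Complex.exp (Complex.I * θ)) * Complex.I_sq
      rw [rayShift, smul_smul, add_smul, this]
      abel
    · rw [rayShift, smul_smul, add_smul, Matrix.conjTranspose_sub, Matrix.conjTranspose_sub,
        Matrix.conjTranspose_add, Matrix.conjTranspose_smul, Matrix.conjTranspose_smul,
        Matrix.conjTranspose_one, star_mul', conj_exp_I_mul, Complex.star_def,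
        Complex.conj_ofReal]
      have : Complex.I * (r : ℂ) * (Complex.I * Complex.exp (-(Complex.I * θ))) =
          -(r * Complex.exp (-(Complex.I * θ))) := by
        linear_combination ((r : ℂ) * Complex.exp (-(Complex.I * θ))) * Complex.I_sq
      rw [this, neg_smul]
      abel
  rw [this]

lemma rayShift_apply (A : Matrix (Fin m) (Fin m) ℂ) (z₀ : ℂ) (r θ : ℝ)
    (v : EuclideanSpace ℂ (Fin m)) :
    op (rayShift A z₀ r θ) v = op A v - (z₀ + (r : ℂ) * Complex.exp (Complex.I * θ)) • v :=
  op_sub_smul_one_apply _ _ _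

/-! ### Pseudospectrum and rays -/

/-- Membership in the pseudospectrum through approximate eigenvectors. -/
lemma mem_pseudospectrum_iff (A : Matrix (Fin m) (Fin m) ℂ) {ε : ℝ} (z : ℂ) :
    z ∈ pseudospectrum ε A ↔
      ∃ v : EuclideanSpace ℂ (Fin m), ‖v‖ = 1 ∧ ‖op A v - z • v‖ ≤ ε := by
  constructor
  · rintro ⟨Δ, hΔ, hz⟩
    rw [← AlgEquiv.spectrum_eq (Matrix.toLinAlgEquiv' (R := ℂ) (n := Fin m)),
      ← Module.End.hasEigenvalue_iff_mem_spectrum] at hz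
    obtain ⟨w, hw⟩ := hz.exists_hasEigenvector
    have hw1 : (A + Δ) *ᵥ w = z • w := by
      simpa [Matrix.add_mulVec] using hw.apply_eq_smul
    have hw0 : WithLp.toLp 2 w ≠ 0 := by simpa using hw.2
    set u : EuclideanSpace ℂ (Fin m) := WithLp.toLp 2 w
    have hu : op A u + op Δ u = z • u := by
      rw [← _root_.add_apply, op, op, ← map_add, Matrix.toEuclideanCLM_toLp, hw1]
      rfl
    have hun : ‖u‖ ≠ 0 := norm_ne_zero_iff.2 hw0
    have h1 : ‖((‖u‖⁻¹ : ℝ) : ℂ) • u‖ = 1 := by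
      rw [norm_smul, Complex.norm_real, norm_inv, norm_norm, inv_mul_cancel₀ hun]
    refine ⟨((‖u‖⁻¹ : ℝ) : ℂ) • u, h1, ?_⟩
    have h2 : op A (((‖u‖⁻¹ : ℝ) : ℂ) • u) - z • ((‖u‖⁻¹ : ℝ) : ℂ) • u =
        -(op Δ (((‖u‖⁻¹ : ℝ) : ℂ) • u)) := by
      rw [map_smul, map_smul, smul_comm z, ← smul_sub, ← hu]
      simp
    rw [h2, norm_neg]
    refine ((op Δ).le_opNorm _).trans ?_
    rw [h1, mul_one]
    exact hΔ
  · rintro ⟨v, hv, h⟩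
    set u := op A v - z • v
    -- The perturbation is the rank-one operator `-u v*`: its norm is `‖u‖ ‖v‖ = ‖u‖`, and it sends
    -- `v` to `-u`, so that `v` becomes an exact eigenvector for `z`.
    refine ⟨(Matrix.toEuclideanCLM (n := Fin m) (𝕜 := ℂ)).symm
      (-(InnerProductSpace.rankOne ℂ u v)), ?_, ?_⟩
    · rw [StarAlgEquiv.apply_symm_apply, norm_neg, InnerProductSpace.norm_rankOne, hv, mul_one]
      exact h
    · rw [← AlgEquiv.spectrum_eq
          (Matrix.toEuclideanCLM (n := Fin m) (𝕜 := ℂ)).toAlgEquiv]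
      change z ∈ spectrum ℂ (Matrix.toEuclideanCLM (n := Fin m) (𝕜 := ℂ) _)
      rw [map_add, StarAlgEquiv.apply_symm_apply, spectrum.mem_iff]
      intro hunit
      have h0 : (algebraMap ℂ (EuclideanSpace ℂ (Fin m) →L[ℂ] EuclideanSpace ℂ (Fin m)) z -
          (op A + -(InnerProductSpace.rankOne ℂ u v))) v = 0 := by
        simp [Algebra.algebraMap_eq_smul_one, hv, u]
      obtain ⟨U, hU⟩ := hunit
      have h1 := congrArg (fun f => f v) (Units.inv_mul U)
      simp only [hU] at h1
      change (U⁻¹ : (EuclideanSpace ℂ (Fin m) →L[ℂ] EuclideanSpace ℂ (Fin m))ˣ).val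
        ((algebraMap ℂ (EuclideanSpace ℂ (Fin m) →L[ℂ] EuclideanSpace ℂ (Fin m)) z -
          (op A + -(InnerProductSpace.rankOne ℂ u v))) v) = v at h1
      rw [h0, map_zero] at h1
      simp [← h1] at hv

lemma mem_ray_inter_pseudospectrum_iff (A : Matrix (Fin m) (Fin m) ℂ) (z₀ : ℂ) (ε θ : ℝ) :
    (ray z₀ θ ∩ pseudospectrum ε A).Nonempty ↔
      ∃ r : ℝ, 0 < r ∧ ∃ v : EuclideanSpace ℂ (Fin m), ‖v‖ = 1 ∧ ‖op (rayShift A z₀ r θ) v‖ ≤ ε := by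
  simp only [rayShift_apply]
  constructor
  · rintro ⟨z, ⟨r, hr, rfl⟩, hz⟩
    exact ⟨r, hr, (mem_pseudospectrum_iff _ _).1 hz⟩
  · rintro ⟨r, hr, h⟩
    exact ⟨_, ⟨r, hr, rfl⟩, (mem_pseudospectrum_iff _ _).2 h⟩

/-- Along a ray, the last point of the pseudospectrum has `ε` as a singular value. -/
lemma exists_singularValue_of_ray (A : Matrix (Fin m) (Fin m) ℂ) (z₀ : ℂ) {ε : ℝ} (hε : 0 ≤ ε)
    (θ r₀ : ℝ) (h : ∃ v : EuclideanSpace ℂ (Fin m), ‖v‖ = 1 ∧ ‖op (rayShift A z₀ r₀ θ) v‖ ≤ ε) :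
    ∃ r, r₀ ≤ r ∧ ε ∈ singularValueSet (rayShift A z₀ r θ) := by
  have hcont : Continuous fun p : ℝ × EuclideanSpace ℂ (Fin m) =>
      op (rayShift A z₀ p.1 θ) p.2 := by
    simp only [rayShift_apply]
    fun_prop
  have hbdd : ∀ r (v : EuclideanSpace ℂ (Fin m)), ‖v‖ = 1 → ‖op (rayShift A z₀ r θ) v‖ ≤ ε →
      r ≤ ‖op A‖ + ‖z₀‖ + ε := by
    intro r v hv hr
    have e1 : ((r : ℂ) * Complex.exp (Complex.I * θ)) • v =
        op A v - z₀ • v - op (rayShift A z₀ r θ) v := by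
      rw [rayShift_apply, add_smul]; abel
    have e2 : ‖((r : ℂ) * Complex.exp (Complex.I * θ)) • v‖ = |r| := by
      rw [norm_smul, hv, norm_mul, mul_comm Complex.I, Complex.norm_exp_ofReal_mul_I]
      simp
    have e3 : ‖op A v‖ ≤ ‖op A‖ := by simpa [hv] using (op A).le_opNorm v
    have e4 : ‖z₀ • v‖ = ‖z₀‖ := by rw [norm_smul, hv, mul_one]
    calc r ≤ |r| := le_abs_self r
      _ = ‖op A v - z₀ • v - op (rayShift A z₀ r θ) v‖ := by rw [← e2, e1]
      _ ≤ ‖op A v‖ + ‖z₀ • v‖ + ‖op (rayShift A z₀ r θ) v‖ :=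
          (norm_sub_le _ _).trans (add_le_add_left (norm_sub_le _ _) _)
      _ ≤ _ := by rw [e4]; gcongr
  -- Maximising `r` over this compact set of pairs `(r, v)` finds the last point of the
  -- pseudospectrum on the ray.
  set K : Set (ℝ × EuclideanSpace ℂ (Fin m)) :=
    (Set.Icc r₀ (‖op A‖ + ‖z₀‖ + ε) ×ˢ Metric.sphere 0 1) ∩
      {p | ‖op (rayShift A z₀ p.1 θ) p.2‖ ≤ ε} with hK
  have hKc : IsCompact K := (isCompact_Icc.prod (isCompact_sphere _ _)).inter_right
    (isClosed_le hcont.norm continuous_const)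
  obtain ⟨v₀, hv₀, hv₀ε⟩ := h
  obtain ⟨⟨r, v⟩, hrv, hmax⟩ := hKc.exists_isMaxOn
    ⟨(r₀, v₀), ⟨⟨⟨le_rfl, hbdd r₀ v₀ hv₀ hv₀ε⟩, by simpa using hv₀⟩, hv₀ε⟩⟩ continuous_fst.continuousOn
  obtain ⟨⟨⟨hr0, -⟩, hv⟩, hvε⟩ := hrv
  simp only [mem_sphere_zero_iff_norm] at hv hr0
  refine ⟨r, hr0, mem_singularValueSet_of_isMin hε hv hvε fun w hw => ?_⟩
  -- Beyond the maximal `r` every unit vector has residual at least `ε`; letting `s` decrease to `r`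
  -- keeps this bound, so `ε` is the minimum at `r`.
  have hlim : Filter.Tendsto (fun s => ‖op (rayShift A z₀ s θ) w‖) (nhdsWithin r (Set.Ioi r))
      (nhds ‖op (rayShift A z₀ r θ) w‖) :=
    ((hcont.comp (continuous_id.prodMk continuous_const)).norm.tendsto r).mono_left
      nhdsWithin_le_nhds
  refine ge_of_tendsto hlim (Filter.eventually_of_mem self_mem_nhdsWithin fun s hs => ?_)
  by_contra! hlt
  have : (s, w) ∈ K :=
    ⟨⟨⟨hr0.trans (le_of_lt hs), hbdd s w hw hlt.le⟩, by simpa using hw⟩, hlt.le⟩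
  exact absurd (show s ≤ r from hmax this) (not_le.2 hs)

/-- A ray meets the `ε`-pseudospectrum iff the pencil has an eigenvalue `i r` with `r > 0`. -/
lemma exists_pencil_iff_ray (A : Matrix (Fin m) (Fin m) ℂ) (z₀ : ℂ) {ε : ℝ} (hε : 0 ≤ ε) (θ : ℝ) :
    (∃ r : ℝ, 0 < r ∧ Complex.I * (r : ℂ) ∈ pencilSpectrum (matC A z₀ ε) (matD m θ)) ↔
      (ray z₀ θ ∩ pseudospectrum ε A).Nonempty := by
  rw [mem_ray_inter_pseudospectrum_iff]
  simp only [I_mul_mem_pencilSpectrum_iff A z₀ hε]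
  constructor
  · rintro ⟨r, hr, h⟩
    obtain ⟨v, hv, hvε⟩ := exists_unit_norm_op_eq hε h
    exact ⟨r, hr, v, hv, hvε.le⟩
  · rintro ⟨r, hr, h⟩
    obtain ⟨s, hs, h⟩ := exists_singularValue_of_ray A z₀ hε θ r h
    exact ⟨s, hr.trans_le hs, h⟩

lemma rayShift_zero (A : Matrix (Fin m) (Fin m) ℂ) (z₀ : ℂ) (θ : ℝ) :
    rayShift A z₀ 0 θ = A - z₀ • (1 : Matrix (Fin m) (Fin m) ℂ) := by
  simp [rayShift]

lemma zero_notMem_pencilSpectrum (A : Matrix (Fin m) (Fin m) ℂ) (z₀ : ℂ) {ε : ℝ} (hε : 0 ≤ ε)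
    (h : ε ∉ singularValueSet (A - z₀ • (1 : Matrix (Fin m) (Fin m) ℂ))) (θ : ℝ) :
    0 ∉ pencilSpectrum (matC A z₀ ε) (matD m θ) := by
  have := (I_mul_mem_pencilSpectrum_iff A z₀ hε θ 0).not.2 (by rwa [rayShift_zero])
  simpa using this

/-- If some unit vector has `‖(A - z₀) v‖ < ε`, then every ray from `z₀` meets `Λ_ε(A)`. -/
lemma ray_inter_nonempty_of_lt (A : Matrix (Fin m) (Fin m) ℂ) (z₀ : ℂ) {ε : ℝ}
    {v : EuclideanSpace ℂ (Fin m)} (hv : ‖v‖ = 1) (h : ‖op A v - z₀ • v‖ < ε) (θ : ℝ) :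
    (ray z₀ θ ∩ pseudospectrum ε A).Nonempty := by
  rw [mem_ray_inter_pseudospectrum_iff]
  have hcont : Continuous fun r : ℝ => ‖op (rayShift A z₀ r θ) v‖ := by
    simp only [rayShift_apply]
    fun_prop
  have h0 : ‖op (rayShift A z₀ 0 θ) v‖ < ε := by
    rw [rayShift_apply]; simpa using h
  have hev : ∀ᶠ r in nhdsWithin (0 : ℝ) (Set.Ioi 0), ‖op (rayShift A z₀ r θ) v‖ < ε :=
    nhdsWithin_le_nhds (hcont.continuousAt.eventually_lt continuousAt_const h0)
  obtain ⟨r, hr, hr0⟩ := (hev.and self_mem_nhdsWithin).exists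
  exact ⟨r, hr0, v, hv, hr.le⟩

/-- As `ε` is not a singular value of `A - z₀`, it cannot equal the minimal residual at `z₀`. That
residual is therefore strictly below `ε`, which leaves room to move along any ray. -/
lemma ray_inter_nonempty_of_mem (A : Matrix (Fin m) (Fin m) ℂ) (z₀ : ℂ) {ε : ℝ} (hε : 0 ≤ ε)
    (h : ε ∉ singularValueSet (A - z₀ • (1 : Matrix (Fin m) (Fin m) ℂ)))
    (hz : z₀ ∈ pseudospectrum ε A) (θ : ℝ) : (ray z₀ θ ∩ pseudospectrum ε A).Nonempty := by
  obtain ⟨v, hv, hvε⟩ := (mem_pseudospectrum_iff _ _).1 hz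
  by_contra hne
  refine h (mem_singularValueSet_of_isMin hε hv (by rwa [op_sub_smul_one_apply]) fun w hw => ?_)
  by_contra! hlt
  rw [op_sub_smul_one_apply] at hlt
  exact hne (ray_inter_nonempty_of_lt A z₀ hw hlt θ)

/-! ### Reduction to a standard eigenvalue problem, and the reflection symmetry -/

/-- The inverse of `D_θ`. -/
def matDInv (m : ℕ) (θ : ℝ) : Matrix (Fin m ⊕ Fin m) (Fin m ⊕ Fin m) ℂ :=
  Matrix.fromBlocks
    ((Complex.I * Complex.exp (-(Complex.I * θ))) • (1 : Matrix (Fin m) (Fin m) ℂ))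
    0
    0
    ((-Complex.I * Complex.exp (Complex.I * θ)) • (1 : Matrix (Fin m) (Fin m) ℂ))

lemma matD_mul_matDInv (m : ℕ) (θ : ℝ) : matD m θ * matDInv m θ = 1 := by
  have h1 : Complex.I * Complex.exp (-(Complex.I * θ)) *
      (-Complex.I * Complex.exp (Complex.I * θ)) = 1 := by
    have : Complex.exp (-(Complex.I * θ)) * Complex.exp (Complex.I * θ) = 1 := by
      rw [← Complex.exp_add, neg_add_cancel, Complex.exp_zero]
    linear_combination (-(Complex.exp (-(Complex.I * θ)) * Complex.exp (Complex.I * θ))) *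
      Complex.I_sq + this
  rw [matD, matDInv, Matrix.fromBlocks_multiply, ← Matrix.fromBlocks_one, Matrix.fromBlocks_inj]
  refine ⟨?_, by simp, by simp, ?_⟩ <;>
    simp only [Matrix.smul_mul, Matrix.mul_smul, Matrix.one_mul, smul_smul, Matrix.zero_mul,
      add_zero, zero_add, h1, mul_comm (-Complex.I * Complex.exp (Complex.I * θ)), one_smul]

/-- The pencil `(C, D_θ)` reduced to a standard eigenvalue problem. -/
def redMat (A : Matrix (Fin m) (Fin m) ℂ) (z₀ : ℂ) (ε θ : ℝ) :
    Matrix (Fin m ⊕ Fin m) (Fin m ⊕ Fin m) ℂ :=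
  matDInv m θ * matC A z₀ ε

lemma det_matD_ne_zero (m : ℕ) (θ : ℝ) : (matD m θ).det ≠ 0 := by
  intro h
  have := congrArg Matrix.det (matD_mul_matDInv m θ)
  simp [h] at this

lemma matC_sub_smul_matD (A : Matrix (Fin m) (Fin m) ℂ) (z₀ : ℂ) (ε θ : ℝ) (l : ℂ) :
    matC A z₀ ε - l • matD m θ = -(matD m θ * (l • 1 - redMat A z₀ ε θ)) := by
  rw [mul_sub, redMat, ← mul_assoc, matD_mul_matDInv, one_mul, Matrix.mul_smul, mul_one, neg_sub]

lemma mem_pencilSpectrum_iff (A : Matrix (Fin m) (Fin m) ℂ) (z₀ : ℂ) (ε θ : ℝ) (l : ℂ) :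
    l ∈ pencilSpectrum (matC A z₀ ε) (matD m θ) ↔ (redMat A z₀ ε θ).charpoly.eval l = 0 := by
  rw [pencilSpectrum, Set.mem_ofPred_eq, matC_sub_smul_matD, Matrix.det_neg, Matrix.det_mul,
    Matrix.eval_charpoly, Matrix.scalar_apply, ← Matrix.smul_one_eq_diagonal]
  simp [det_matD_ne_zero]

lemma pencilSpectrum_subset_spectrum (A : Matrix (Fin m) (Fin m) ℂ) (z₀ : ℂ) (ε θ : ℝ) :
    pencilSpectrum (matC A z₀ ε) (matD m θ) ⊆ spectrum ℂ (redMat A z₀ ε θ) := fun _ hl =>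
  Matrix.mem_spectrum_iff_isRoot_charpoly.2 ((mem_pencilSpectrum_iff _ _ _ _ _).1 hl)

lemma finite_pencilSpectrum (A : Matrix (Fin m) (Fin m) ℂ) (z₀ : ℂ) (ε θ : ℝ) :
    (pencilSpectrum (matC A z₀ ε) (matD m θ)).Finite := by
  refine ((redMat A z₀ ε θ).charpoly.finite_setOfPred_isRoot
    (Matrix.charpoly_monic _).ne_zero).subset fun l hl => ?_
  exact (mem_pencilSpectrum_iff _ _ _ _ _).1 hl

lemma pencilSpectrum_nonempty (hm : 0 < m) (A : Matrix (Fin m) (Fin m) ℂ) (z₀ : ℂ) (ε θ : ℝ) :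
    (pencilSpectrum (matC A z₀ ε) (matD m θ)).Nonempty := by
  obtain ⟨l, hl⟩ := IsAlgClosed.exists_root (redMat A z₀ ε θ).charpoly (by
    rw [Matrix.charpoly_degree_eq_dim]
    simp only [Fintype.card_sum, Fintype.card_fin]
    exact_mod_cast (by omega : m + m ≠ 0))
  exact ⟨l, (mem_pencilSpectrum_iff _ _ _ _ _).2 hl⟩

/-- The spectrum of the pencil is symmetric with respect to the imaginary axis. -/
lemma neg_conj_mem_pencilSpectrum {A : Matrix (Fin m) (Fin m) ℂ} {z₀ : ℂ} {ε θ : ℝ} {l : ℂ}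
    (hl : l ∈ pencilSpectrum (matC A z₀ ε) (matD m θ)) :
    -star l ∈ pencilSpectrum (matC A z₀ ε) (matD m θ) := by
  -- `P` is the symplectic unit and `P'` its inverse; conjugating by them sends `Cᴴ` to `-C` and
  -- `D_θᴴ` to `D_θ`.
  set P : Matrix (Fin m ⊕ Fin m) (Fin m ⊕ Fin m) ℂ := Matrix.fromBlocks 0 1 (-1) 0 with hP
  set P' : Matrix (Fin m ⊕ Fin m) (Fin m ⊕ Fin m) ℂ := Matrix.fromBlocks 0 (-1) 1 0 with hP'
  have hconj : star (Complex.exp (-(Complex.I * θ))) = Complex.exp (Complex.I * θ) := by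
    rw [← conj_exp_I_mul, star_star]
  have key : matC A z₀ ε - (-star l) • matD m θ = -(P * (matC A z₀ ε - l • matD m θ)ᴴ * P') := by
    have h1 : P * (matC A z₀ ε)ᴴ * P' = -matC A z₀ ε := by
      rw [hP, hP', matC, Matrix.fromBlocks_conjTranspose, Matrix.fromBlocks_multiply,
        Matrix.fromBlocks_multiply, Matrix.fromBlocks_neg]
      simp
    have h2 : P * (matD m θ)ᴴ * P' = matD m θ := by
      rw [hP, hP', matD, Matrix.fromBlocks_conjTranspose, Matrix.fromBlocks_multiply,
        Matrix.fromBlocks_multiply, Matrix.conjTranspose_smul, Matrix.conjTranspose_smul,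
        star_mul', star_mul', conj_exp_I_mul, hconj]
      simp
    rw [Matrix.conjTranspose_sub, Matrix.conjTranspose_smul, mul_sub, sub_mul, h1, Matrix.mul_smul,
      Matrix.smul_mul, h2, neg_smul]
    abel
  rw [pencilSpectrum, Set.mem_ofPred_eq] at hl ⊢
  rw [key, Matrix.det_neg, Matrix.det_mul, Matrix.det_mul, Matrix.det_conjTranspose, hl]
  simp

/-- After multiplication by `-i` the reflection is complex conjugation, which negates the argument
or fixes the value `π`; the square sees neither. -/
lemma sqArg_neg_conj (l : ℂ) : sqArg (-star l) = sqArg l := by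
  have : -Complex.I * -star l = star (-Complex.I * l) := by
    simp
  rw [sqArg, sqArg, this, Complex.star_def, Complex.arg_conj]
  split_ifs with h
  · rw [h]
  · rw [neg_sq]

/-- Squaring removes the jump of `Arg` on the negative axis: `|Arg w|` is the unoriented angle
between `1` and `w`. -/
lemma continuousAt_sqArg {l : ℂ} (hl : l ≠ 0) : ContinuousAt sqArg l := by
  have h1 : (fun l => (InnerProductGeometry.angle (1 : ℂ) (-Complex.I * l)) ^ 2) =ᶠ[𝓝 l] sqArg := by
    filter_upwards [isOpen_ne.mem_nhds hl] with x hx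
    rw [Complex.angle_one_left (mul_ne_zero (by simp) hx), sq_abs, sqArg]
  refine ContinuousAt.congr ?_ h1
  have h2 : ContinuousAt (fun x : ℂ => ((1 : ℂ), -Complex.I * x)) l := by fun_prop
  have h3 := InnerProductGeometry.continuousAt_angle (x := ((1 : ℂ), -Complex.I * l)) one_ne_zero
    (mul_ne_zero (by simp) hl)
  exact (ContinuousAt.comp (f := fun x : ℂ => ((1 : ℂ), -Complex.I * x)) h3 h2).pow 2

lemma leftEigenvalues_nonempty (hm : 0 < m) (A : Matrix (Fin m) (Fin m) ℂ) (z₀ : ℂ) (ε θ : ℝ) :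
    (leftEigenvalues A z₀ ε θ).Nonempty := by
  obtain ⟨l, hl⟩ := pencilSpectrum_nonempty hm A z₀ ε θ
  rcases le_total l.re 0 with h | h
  · exact ⟨l, hl, h⟩
  · exact ⟨-star l, neg_conj_mem_pencilSpectrum hl, by simpa using h⟩

lemma isLeast_aFun (hm : 0 < m) (A : Matrix (Fin m) (Fin m) ℂ) (z₀ : ℂ) (ε θ : ℝ) :
    IsLeast (sqArg '' leftEigenvalues A z₀ ε θ) (aFun A z₀ ε θ) := by
  have hfin : (sqArg '' leftEigenvalues A z₀ ε θ).Finite :=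
    ((finite_pencilSpectrum A z₀ ε θ).subset fun _ h => h.1).image _
  exact ⟨((leftEigenvalues_nonempty hm A z₀ ε θ).image _).csInf_mem hfin,
    fun _ h => csInf_le hfin.bddBelow h⟩

lemma aFun_nonneg (A : Matrix (Fin m) (Fin m) ℂ) (z₀ : ℂ) (ε θ : ℝ) : 0 ≤ aFun A z₀ ε θ :=
  Real.sInf_nonneg (by rintro _ ⟨l, -, rfl⟩; exact sq_nonneg _)

/-- The function `a_ε` may be computed from the whole spectrum. -/
lemma aFun_le_sqArg (hm : 0 < m) {A : Matrix (Fin m) (Fin m) ℂ} {z₀ : ℂ} {ε θ : ℝ} {l : ℂ}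
    (hl : l ∈ pencilSpectrum (matC A z₀ ε) (matD m θ)) : aFun A z₀ ε θ ≤ sqArg l := by
  rcases le_total l.re 0 with h | h
  · exact (isLeast_aFun hm A z₀ ε θ).2 ⟨l, ⟨hl, h⟩, rfl⟩
  · exact (isLeast_aFun hm A z₀ ε θ).2
      ⟨-star l, ⟨neg_conj_mem_pencilSpectrum hl, by simpa using h⟩, sqArg_neg_conj l⟩

lemma aFun_eq_zero_iff (hm : 0 < m) (A : Matrix (Fin m) (Fin m) ℂ) (z₀ : ℂ) {ε : ℝ} (θ : ℝ)
    (h0 : 0 ∉ pencilSpectrum (matC A z₀ ε) (matD m θ)) :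
    aFun A z₀ ε θ = 0 ↔
      ∃ r : ℝ, 0 < r ∧ Complex.I * (r : ℂ) ∈ pencilSpectrum (matC A z₀ ε) (matD m θ) := by
  constructor
  · intro h
    obtain ⟨l, hl, hla⟩ := (isLeast_aFun hm A z₀ ε θ).1
    rw [h, sqArg, sq_eq_zero_iff, Complex.arg_eq_zero_iff] at hla
    -- By convention `Complex.arg 0 = 0`, so a zero eigenvalue would spoil the equivalence and has
    -- to be excluded.
    have hl0 : l ≠ 0 := fun h => h0 (h ▸ hl.1)
    have hlr : l = Complex.I * ((-Complex.I * l).re : ℂ) := by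
      have : ((-Complex.I * l).re : ℂ) = -Complex.I * l := Complex.ext (by simp) (by
        rw [hla.2, Complex.ofReal_im])
      rw [this]
      linear_combination l * Complex.I_sq
    refine ⟨(-Complex.I * l).re, lt_of_le_of_ne hla.1 fun h => hl0 ?_, hlr ▸ hl.1⟩
    rw [hlr, ← h]
    simp
  · rintro ⟨r, hr, h⟩
    refine le_antisymm ((aFun_le_sqArg hm h).trans (le_of_eq ?_)) (aFun_nonneg _ _ _ _)
    have : -Complex.I * (Complex.I * (r : ℂ)) = r := by
      linear_combination (-(r : ℂ)) * Complex.I_sq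
    rw [sqArg, this, Complex.arg_ofReal_of_nonneg hr.le, sq, zero_mul]

/-! ### Continuity in the angle -/

lemma continuous_matD : Continuous (matD m) := by
  unfold matD
  fun_prop

lemma continuous_redMat (A : Matrix (Fin m) (Fin m) ℂ) (z₀ : ℂ) (ε : ℝ) :
    Continuous (redMat A z₀ ε) := by
  unfold redMat matDInv
  fun_prop

lemma isClosed_pencilSpectrum (A : Matrix (Fin m) (Fin m) ℂ) (z₀ : ℂ) (ε : ℝ) :
    IsClosed {p : ℝ × ℂ | p.2 ∈ pencilSpectrum (matC A z₀ ε) (matD m p.1)} := by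
  have : Continuous fun p : ℝ × ℂ => (matC A z₀ ε - p.2 • matD m p.1).det :=
    (continuous_const.sub (continuous_snd.smul (continuous_matD.comp continuous_fst))).matrix_det
  exact isClosed_eq this continuous_const

lemma isClosed_leftEigenvalues (A : Matrix (Fin m) (Fin m) ℂ) (z₀ : ℂ) (ε : ℝ) :
    IsClosed {p : ℝ × ℂ | p.2 ∈ leftEigenvalues A z₀ ε p.1} :=
  (isClosed_pencilSpectrum A z₀ ε).inter
    (isClosed_le (Complex.continuous_re.comp continuous_snd) continuous_const)

/-- The eigenvalues of the pencil are bounded uniformly near an angle. -/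
lemma exists_bound_pencilSpectrum (A : Matrix (Fin m) (Fin m) ℂ) (z₀ : ℂ) (ε θ : ℝ) :
    ∃ R : ℝ, ∀ᶠ t in 𝓝 θ, pencilSpectrum (matC A z₀ ε) (matD m t) ⊆ Metric.closedBall 0 R := by
  let _ := Matrix.linftyOpNormedRing (n := Fin m ⊕ Fin m) (α := ℂ)
  let _ := Matrix.linftyOpNormedAlgebra (R := ℂ) (n := Fin m ⊕ Fin m) (α := ℂ)
  have hcont : Continuous fun t => ‖redMat A z₀ ε t‖ := (continuous_redMat A z₀ ε).norm
  set c := ‖(1 : Matrix (Fin m ⊕ Fin m) (Fin m ⊕ Fin m) ℂ)‖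
  refine ⟨(‖redMat A z₀ ε θ‖ + 1) * c, ?_⟩
  filter_upwards [hcont.continuousAt.eventually_lt continuousAt_const (lt_add_one _)] with t ht l hl
  rw [mem_closedBall_zero_iff]
  refine (spectrum.norm_le_norm_mul_of_mem (pencilSpectrum_subset_spectrum A z₀ ε t hl)).trans ?_
  exact mul_le_mul_of_nonneg_right ht.le (norm_nonneg _)

/-- A monic polynomial whose roots are far from a point is large at this point. -/
lemma pow_le_norm_eval_of_monic {p : Polynomial ℂ} (hp : p.Monic) {l : ℂ} {δ : ℝ} (hδ : 0 ≤ δ)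
    (h : ∀ z, p.eval z = 0 → δ ≤ ‖l - z‖) : δ ^ p.natDegree ≤ ‖p.eval l‖ := by
  have hs := IsAlgClosed.splits p
  rw [hs.eval_eq_prod_roots_of_monic hp, hs.natDegree_eq_card_roots]
  have : ∀ s : Multiset ℂ, (∀ z ∈ s, δ ≤ ‖l - z‖) →
      δ ^ Multiset.card s ≤ ‖(s.map (fun z => l - z)).prod‖ := by
    intro s
    induction s using Multiset.induction_on with
    | empty => simp
    | cons a s ih =>
      intro hs
      rw [Multiset.card_cons, Multiset.map_cons, Multiset.prod_cons, norm_mul, pow_succ']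
      exact mul_le_mul (hs a (Multiset.mem_cons_self _ _))
        (ih fun z hz => hs z (Multiset.mem_cons_of_mem hz)) (by positivity) (norm_nonneg _)
  exact this _ fun z hz => h z (Polynomial.isRoot_of_mem_roots hz)

/-- Every eigenvalue persists under small changes of the angle. -/
lemma eventually_exists_near (A : Matrix (Fin m) (Fin m) ℂ) (z₀ : ℂ) (ε θ : ℝ) {l : ℂ}
    (hl : l ∈ pencilSpectrum (matC A z₀ ε) (matD m θ)) {U : Set ℂ} (hU : U ∈ 𝓝 l) :
    ∀ᶠ t in 𝓝 θ, ∃ l' ∈ pencilSpectrum (matC A z₀ ε) (matD m t), l' ∈ U := by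
  obtain ⟨δ, hδ, hball⟩ := Metric.mem_nhds_iff.1 hU
  have hcont : Continuous fun t => ‖(redMat A z₀ ε t).charpoly.eval l‖ := by
    simp only [Matrix.eval_charpoly]
    exact (continuous_const.sub (continuous_redMat A z₀ ε)).matrix_det.norm
  -- The degree is `2m`: if all eigenvalues at `t` were at distance at least `δ` from `l`, the
  -- characteristic polynomial would have modulus at least `δ ^ (2m)` there.
  have h0 : ‖(redMat A z₀ ε θ).charpoly.eval l‖ < δ ^ (m + m) := by
    rw [(mem_pencilSpectrum_iff _ _ _ _ _).1 hl, norm_zero]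
    positivity
  filter_upwards [hcont.continuousAt.eventually_lt continuousAt_const h0] with t ht
  by_contra! hne
  refine absurd ht (not_lt.2 ?_)
  have := pow_le_norm_eval_of_monic (Matrix.charpoly_monic (redMat A z₀ ε t)) (l := l) hδ.le
    fun z hz => by
      by_contra! hlt
      refine hne z ((mem_pencilSpectrum_iff _ _ _ _ _).2 hz) (hball ?_)
      rwa [Metric.mem_ball, dist_comm, dist_eq_norm]
  simpa [Matrix.charpoly_natDegree_eq_dim] using this

/-- The function `a_ε` is continuous. -/
lemma continuous_aFun (hm : 0 < m) (A : Matrix (Fin m) (Fin m) ℂ) (z₀ : ℂ) {ε : ℝ}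
    (h0 : ∀ θ, 0 ∉ pencilSpectrum (matC A z₀ ε) (matD m θ)) : Continuous (aFun A z₀ ε) := by
  refine continuous_iff_continuousAt.2 fun θ => tendsto_order.2 ⟨fun c hc => ?_, fun c hc => ?_⟩
  · obtain ⟨R, hR⟩ := exists_bound_pencilSpectrum A z₀ ε θ
    -- Lower semicontinuity by a tube argument: near each `y` of the ball, either `sqArg` stays
    -- above `c`, or, the graph of left eigenvalues being closed, there are none.
    have := (isCompact_closedBall (0 : ℂ) R).eventually_forall_of_forall_eventually (x₀ := θ)
      (P := fun t y => y ∈ leftEigenvalues A z₀ ε t → c < sqArg y) (fun y _ => by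
        by_cases hy : y ∈ leftEigenvalues A z₀ ε θ
        · have hy0 : y ≠ 0 := fun h => h0 θ (h ▸ hy.1)
          have h1 : ContinuousAt (fun p : ℝ × ℂ => sqArg p.2) (θ, y) :=
            ContinuousAt.comp (f := Prod.snd) (continuousAt_sqArg hy0) continuousAt_snd
          have h2 : c < sqArg y := hc.trans_le (aFun_le_sqArg hm hy.1)
          filter_upwards [continuousAt_const.eventually_lt h1 h2] with p hp _ using hp
        · filter_upwards [(isClosed_leftEigenvalues A z₀ ε).isOpen_compl.mem_nhds
            (x := (θ, y)) hy] with p hp hp' using absurd hp' hp)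
    filter_upwards [this, hR] with t ht hRt
    obtain ⟨l, hl, hla⟩ := (isLeast_aFun hm A z₀ ε t).1
    rw [← hla]
    exact ht l (hRt hl.1) hl
  · obtain ⟨l, hl, hla⟩ := (isLeast_aFun hm A z₀ ε θ).1
    have hl0 : l ≠ 0 := fun h => h0 θ (h ▸ hl.1)
    -- Upper semicontinuity: the minimiser persists. Its perturbation may enter the right
    -- half-plane, which `aFun_le_sqArg` allows.
    have hU : {x | sqArg x < c} ∈ 𝓝 l :=
      (continuousAt_sqArg hl0).eventually_lt continuousAt_const (by rwa [hla])
    filter_upwards [eventually_exists_near A z₀ ε θ hl.1 hU] with t ht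
    obtain ⟨l', hl', hlU⟩ := ht
    exact (aFun_le_sqArg hm hl').trans_lt hlU

/-! ### Differentiability at a unique simple minimiser -/

/-- If the minimiser at `θ` is unique, minimisers at nearby angles are close to it. -/
lemma eventually_minimiser_mem (hm : 0 < m) (A : Matrix (Fin m) (Fin m) ℂ) (z₀ : ℂ) {ε : ℝ}
    (h0 : ∀ θ, 0 ∉ pencilSpectrum (matC A z₀ ε) (matD m θ)) {θ : ℝ} {l : ℂ}
    (huniq : ∀ l' ∈ leftEigenvalues A z₀ ε θ, sqArg l' = aFun A z₀ ε θ → l' = l)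
    {U : Set (ℝ × ℂ)} (hU : U ∈ 𝓝 (θ, l)) :
    ∀ᶠ t in 𝓝 θ, ∀ l' ∈ leftEigenvalues A z₀ ε t, sqArg l' = aFun A z₀ ε t → (t, l') ∈ U := by
  obtain ⟨R, hR⟩ := exists_bound_pencilSpectrum A z₀ ε θ
  have := (isCompact_closedBall (0 : ℂ) R).eventually_forall_of_forall_eventually (x₀ := θ)
    (P := fun t y => y ∈ leftEigenvalues A z₀ ε t → sqArg y = aFun A z₀ ε t → (t, y) ∈ U)
    (fun y _ => by
      by_cases hy : y ∈ leftEigenvalues A z₀ ε θ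
      · by_cases hya : sqArg y = aFun A z₀ ε θ
        · obtain rfl := huniq y hy hya
          filter_upwards [hU] with p hp _ _ using hp
        · have hy0 : y ≠ 0 := fun h => h0 θ (h ▸ hy.1)
          have h1 : ContinuousAt (fun p : ℝ × ℂ => sqArg p.2) (θ, y) :=
            ContinuousAt.comp (f := Prod.snd) (continuousAt_sqArg hy0) continuousAt_snd
          have h2 : ContinuousAt (fun p : ℝ × ℂ => aFun A z₀ ε p.1) (θ, y) :=
            ((continuous_aFun hm A z₀ h0).comp continuous_fst).continuousAt
          filter_upwards [(h1.sub h2).eventually_ne (sub_ne_zero.2 hya)] with p hp _ hp'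
            using absurd hp' (sub_ne_zero.1 hp)
      · filter_upwards [(isClosed_leftEigenvalues A z₀ ε).isOpen_compl.mem_nhds
          (x := (θ, y)) hy] with p hp hp' using absurd hp' hp)
  filter_upwards [this, hR] with t ht hRt l' hl'
  exact ht l' (hRt hl'.1) hl'

lemma eval_pencilPoly {n : Type*} [Fintype n] [DecidableEq n] (P Q : Matrix n n ℂ) (l : ℂ) :
    (pencilPoly P Q).eval l = (P - l • Q).det := by
  rw [pencilPoly, ← Polynomial.coe_evalRingHom, RingHom.map_det]
  congr 1
  ext i j
  simp
  ring

lemma contDiff_det {n E : Type*} [Fintype n] [DecidableEq n] [NormedAddCommGroup E]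
    [NormedSpace ℝ E] {M : E → Matrix n n ℂ} {k : WithTop ℕ∞}
    (h : ∀ i j, ContDiff ℝ k fun x => M x i j) : ContDiff ℝ k fun x => (M x).det := by
  simp only [Matrix.det_apply]
  exact ContDiff.sum fun σ _ => ContDiff.const_smul _ (contDiff_prod fun i _ => h _ _)

lemma contDiff_det_pencil (A : Matrix (Fin m) (Fin m) ℂ) (z₀ : ℂ) (ε : ℝ) :
    ContDiff ℝ 1 fun p : ℝ × ℂ => (matC A z₀ ε - p.2 • matD m p.1).det := by
  have he : ContDiff ℝ 1 fun p : ℝ × ℂ => Complex.exp (Complex.I * (p.1 : ℂ)) := by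
    have : ContDiff ℝ 1 fun p : ℝ × ℂ => (p.1 : ℂ) :=
      Complex.ofRealCLM.contDiff.comp contDiff_fst
    exact (contDiff_const.mul this).cexp
  have he' : ContDiff ℝ 1 fun p : ℝ × ℂ => Complex.exp (-(Complex.I * (p.1 : ℂ))) := by
    have : ContDiff ℝ 1 fun p : ℝ × ℂ => (p.1 : ℂ) :=
      Complex.ofRealCLM.contDiff.comp contDiff_fst
    exact (contDiff_const.mul this).neg.cexp
  refine contDiff_det fun i j => ?_
  simp only [Matrix.sub_apply, Matrix.smul_apply, smul_eq_mul]
  refine contDiff_const.sub (contDiff_snd.mul ?_)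
  rcases i with i | i <;> rcases j with j | j <;>
    simp only [matD, Matrix.fromBlocks_apply₁₁, Matrix.fromBlocks_apply₁₂,
      Matrix.fromBlocks_apply₂₁, Matrix.fromBlocks_apply₂₂, Matrix.smul_apply, smul_eq_mul,
      Matrix.zero_apply] <;> fun_prop

lemma derivative_pencilPoly_ne_zero {n : Type*} [Fintype n] [DecidableEq n] {P Q : Matrix n n ℂ}
    {l : ℂ} (h : IsSimplePencilEigenvalue P Q l) :
    (pencilPoly P Q).derivative.eval l ≠ 0 := by
  unfold IsSimplePencilEigenvalue at h
  -- The zero polynomial has root multiplicity `0` by convention, so multiplicity one excludes it.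
  have hp : pencilPoly P Q ≠ 0 := by
    rintro h0
    simp [h0] at h
  intro hd
  have hr : (pencilPoly P Q).IsRoot l := (Polynomial.rootMultiplicity_pos hp).1 (by omega)
  have := (Polynomial.one_lt_rootMultiplicity_iff_isRoot hp).2 ⟨hr, hd⟩
  omega

/-- A simple eigenvalue of the pencil continues uniquely and differentiably in the angle. -/
lemma exists_eigenvalue_branch (A : Matrix (Fin m) (Fin m) ℂ) (z₀ : ℂ) (ε θ : ℝ) {l : ℂ}
    (hl : l ∈ pencilSpectrum (matC A z₀ ε) (matD m θ))
    (hs : IsSimplePencilEigenvalue (matC A z₀ ε) (matD m θ) l) :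
    ∃ φ : ℝ → ℂ, DifferentiableAt ℝ φ θ ∧ φ θ = l ∧
      {p : ℝ × ℂ | p.2 ∈ pencilSpectrum (matC A z₀ ε) (matD m p.1) ↔ φ p.1 = p.2} ∈ 𝓝 (θ, l) := by
  set q : ℝ × ℂ → ℂ := fun p => (matC A z₀ ε - p.2 • matD m p.1).det with hq
  have hq0 : q (θ, l) = 0 := hl
  have hstrict : HasStrictFDerivAt q (fderiv ℝ q (θ, l)) (θ, l) :=
    (contDiff_det_pencil A z₀ ε).contDiffAt.hasStrictFDerivAt one_ne_zero
  set c := (pencilPoly (matC A z₀ ε) (matD m θ)).derivative.eval l with hc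
  have hc0 : c ≠ 0 := derivative_pencilPoly_ne_zero hs
  have h1 : HasFDerivAt (fun y : ℂ => q (θ, y))
      (fderiv ℝ q (θ, l) ∘L ContinuousLinearMap.inr ℝ ℝ ℂ) l :=
    hstrict.hasFDerivAt.comp l (hasFDerivAt_prodMk_right θ l)
  have h2 : HasFDerivAt (fun y : ℂ => q (θ, y))
      ((ContinuousLinearMap.toSpanSingleton ℂ c).restrictScalars ℝ) l := by
    have := ((pencilPoly (matC A z₀ ε) (matD m θ)).hasDerivAt l).hasFDerivAt.restrictScalars ℝ
    simpa only [eval_pencilPoly] using this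
  -- The partial derivative in `λ` is multiplication by `c`, a nonzero number because `l` is simple;
  -- this is the hypothesis of the implicit function theorem, used over `ℝ` as the angle is real.
  have hinv : (fderiv ℝ q (θ, l) ∘L ContinuousLinearMap.inr ℝ ℝ ℂ).IsInvertible := by
    rw [h1.unique h2]
    refine ContinuousLinearMap.IsInvertible.of_inverse
      (g := (ContinuousLinearMap.toSpanSingleton ℂ c⁻¹).restrictScalars ℝ) ?_ ?_ <;>
    ext x <;> simp [hc0]
  refine ⟨hstrict.implicitFunctionOfProdDomain hinv,
    (hstrict.hasStrictFDerivAt_implicitFunctionOfProdDomain hinv).hasFDerivAt.differentiableAt,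
    ?_, ?_⟩
  · exact (hstrict.eventually_apply_eq_iff_implicitFunctionOfProdDomain hinv).self_of_nhds.1 rfl
  · filter_upwards [hstrict.eventually_apply_eq_iff_implicitFunctionOfProdDomain hinv] with p hp
    rwa [hq0] at hp

/-- In the open left half-plane `-i φ` has positive imaginary part, hence avoids the cut of the
logarithm, whose imaginary part is `Arg`. -/
lemma differentiableAt_arg_sq {φ : ℝ → ℂ} {θ : ℝ} (hφ : DifferentiableAt ℝ φ θ)
    (h : (φ θ).re < 0) : DifferentiableAt ℝ (fun t => sqArg (φ t)) θ := by
  have hslit : -Complex.I * φ θ ∈ Complex.slitPlane := by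
    refine Complex.mem_slitPlane_iff.2 (Or.inr ?_)
    simp [h.ne]
  have h1 : DifferentiableAt ℝ (fun t => Complex.log (-Complex.I * φ t)) θ :=
    ((hφ.hasDerivAt.const_mul (-Complex.I)).clog_real hslit).differentiableAt
  have h2 : DifferentiableAt ℝ (fun t => (Complex.log (-Complex.I * φ t)).im) θ :=
    Complex.imCLM.differentiableAt.comp θ h1
  simp only [Complex.log_im] at h2
  exact h2.pow 2

/-- Near `θ` every minimiser lies on the branch `φ` through `l`, so `a_ε = sqArg ∘ φ`. Off the
imaginary axis this is differentiable. If `l` is on the axis, `-conj (φ t)` is also an eigenvalue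
near `l`; uniqueness of the branch forces `φ` to stay on the axis, where `sqArg` is locally
constant, equal to `0` or `π²`. -/
lemma differentiableAt_aFun (hm : 0 < m) (A : Matrix (Fin m) (Fin m) ℂ) (z₀ : ℂ) {ε : ℝ}
    (h0 : ∀ θ, 0 ∉ pencilSpectrum (matC A z₀ ε) (matD m θ)) {θ : ℝ} {l : ℂ}
    (hl : l ∈ leftEigenvalues A z₀ ε θ)
    (huniq : ∀ l' ∈ leftEigenvalues A z₀ ε θ, sqArg l' = aFun A z₀ ε θ → l' = l)
    (hs : IsSimplePencilEigenvalue (matC A z₀ ε) (matD m θ) l) :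
    DifferentiableAt ℝ (aFun A z₀ ε) θ := by
  obtain ⟨φ, hφ, hφθ, hloc⟩ := exists_eigenvalue_branch A z₀ ε θ hl.1 hs
  have hmin : ∀ᶠ t in 𝓝 θ, φ t ∈ leftEigenvalues A z₀ ε t ∧ aFun A z₀ ε t = sqArg (φ t) := by
    filter_upwards [eventually_minimiser_mem hm A z₀ h0 huniq hloc] with t ht
    obtain ⟨l', hl', hla⟩ := (isLeast_aFun hm A z₀ ε t).1
    have : φ t = l' := (ht l' hl' hla).1 hl'.1
    exact ⟨this ▸ hl', by rw [this, hla]⟩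
  rcases hl.2.lt_or_eq with hre | hre
  · refine (differentiableAt_arg_sq hφ (hφθ ▸ hre)).congr_of_eventuallyEq ?_
    filter_upwards [hmin] with t ht using ht.2
  · have hl0 : l ≠ 0 := fun h => h0 θ (h ▸ hl.1)
    have him : l.im ≠ 0 := fun h => hl0 (Complex.ext hre h)
    have hlstar : -star l = l := Complex.ext (by simp [hre]) (by simp)
    have hcont : ContinuousAt (fun t => (t, -star (φ t))) θ :=
      continuousAt_id.prodMk (hφ.continuousAt.star.neg)
    have hloc' : {p : ℝ × ℂ | p.2 ∈ pencilSpectrum (matC A z₀ ε) (matD m p.1) ↔ φ p.1 = p.2} ∈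
        𝓝 (θ, -star (φ θ)) := by rwa [hφθ, hlstar]
    -- The branch stays on the same half of the imaginary axis as `l`, which decides between the
    -- values `0` and `π²`.
    have hsign : ∀ᶠ t in 𝓝 θ, 0 < l.im * (φ t).im := by
      have hc : ContinuousAt (fun t => l.im * (φ t).im) θ :=
        continuousAt_const.mul (Complex.continuous_im.continuousAt.comp hφ.continuousAt)
      exact continuousAt_const.eventually_lt hc (by rw [hφθ]; exact mul_self_pos.2 him)
    have hI : ∀ w : ℂ, w.re = 0 → -Complex.I * w = (w.im : ℂ) := fun w hw =>
      Complex.ext (by simp) (by simp [hw])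
    have hconst : ∀ᶠ t in 𝓝 θ, aFun A z₀ ε t = sqArg l := by
      filter_upwards [hmin, hcont.eventually hloc', hsign] with t ht h1 h2
      have h3 : φ t = -star (φ t) := h1.1 (neg_conj_mem_pencilSpectrum ht.1.1)
      have h4 : (φ t).re = 0 := by
        have := congrArg Complex.re h3
        simp only [Complex.neg_re, Complex.star_def, Complex.conj_re] at this
        linarith
      rw [ht.2, sqArg, sqArg, hI _ h4, hI _ hre]
      rcases him.lt_or_gt with h | h
      · rw [Complex.arg_ofReal_of_neg h, Complex.arg_ofReal_of_neg (by nlinarith)]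
      · rw [Complex.arg_ofReal_of_nonneg h.le, Complex.arg_ofReal_of_nonneg (by nlinarith)]
    exact (differentiableAt_const (sqArg l)).congr_of_eventuallyEq hconst

/-! ### The set of meeting angles and its measure -/

/-- The set of angles of the rays that meet the pseudospectrum. -/
def meetSet (A : Matrix (Fin m) (Fin m) ℂ) (z₀ : ℂ) (ε : ℝ) : Set ℝ :=
  {θ | (ray z₀ θ ∩ pseudospectrum ε A).Nonempty}

lemma periodic_mem_meetSet (A : Matrix (Fin m) (Fin m) ℂ) (z₀ : ℂ) (ε : ℝ) :
    Function.Periodic (· ∈ meetSet A z₀ ε) (2 * Real.pi) := by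
  intro θ
  have : ray z₀ (θ + 2 * Real.pi) = ray z₀ θ := by
    have he : Complex.exp (Complex.I * ((θ + 2 * Real.pi : ℝ) : ℂ)) =
        Complex.exp (Complex.I * θ) := by
      have : Complex.I * ((θ + 2 * Real.pi : ℝ) : ℂ) =
          Complex.I * θ + 2 * Real.pi * Complex.I := by
        push_cast; ring
      rw [this, Complex.exp_periodic]
    simp only [ray, he]
  simp only [meetSet, Set.mem_ofPred_eq, this]

lemma aFun_eq_zero_iff_mem_meetSet (hm : 0 < m) (A : Matrix (Fin m) (Fin m) ℂ) (z₀ : ℂ) {ε : ℝ}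
    (hε : 0 ≤ ε) (h : ε ∉ singularValueSet (A - z₀ • (1 : Matrix (Fin m) (Fin m) ℂ))) (θ : ℝ) :
    aFun A z₀ ε θ = 0 ↔ θ ∈ meetSet A z₀ ε :=
  (aFun_eq_zero_iff hm A z₀ θ (zero_notMem_pencilSpectrum A z₀ hε h θ)).trans
    (exists_pencil_iff_ray A z₀ hε θ)

lemma zeroSet_eq (hm : 0 < m) (A : Matrix (Fin m) (Fin m) ℂ) (z₀ : ℂ) {ε : ℝ}
    (hε : 0 ≤ ε) (h : ε ∉ singularValueSet (A - z₀ • (1 : Matrix (Fin m) (Fin m) ℂ))) :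
    zeroSet A z₀ ε = Set.Ioc (-Real.pi) Real.pi ∩ meetSet A z₀ ε :=
  Set.ext fun θ => and_congr_right fun _ => aFun_eq_zero_iff_mem_meetSet hm A z₀ hε h θ

/-- Rays omit their origin, so compactness of the pseudospectrum alone would not suffice; closedness
comes from continuity of `a_ε`. -/
lemma isClosed_meetSet (hm : 0 < m) (A : Matrix (Fin m) (Fin m) ℂ) (z₀ : ℂ) {ε : ℝ}
    (hε : 0 ≤ ε) (h : ε ∉ singularValueSet (A - z₀ • (1 : Matrix (Fin m) (Fin m) ℂ))) :
    IsClosed (meetSet A z₀ ε) := by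
  have : meetSet A z₀ ε = aFun A z₀ ε ⁻¹' {0} :=
    Set.ext fun θ => (aFun_eq_zero_iff_mem_meetSet hm A z₀ hε h θ).symm
  rw [this]
  exact isClosed_singleton.preimage
    (continuous_aFun hm A z₀ (zero_notMem_pencilSpectrum A z₀ hε h))

lemma pseudospectrum_mono (A : Matrix (Fin m) (Fin m) ℂ) {ε₁ ε₂ : ℝ} (h : ε₁ ≤ ε₂) :
    pseudospectrum ε₁ A ⊆ pseudospectrum ε₂ A := fun _ ⟨Δ, hΔ, hz⟩ => ⟨Δ, hΔ.trans h, hz⟩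

lemma meetSet_mono (A : Matrix (Fin m) (Fin m) ℂ) (z₀ : ℂ) {ε₁ ε₂ : ℝ} (h : ε₁ ≤ ε₂) :
    meetSet A z₀ ε₁ ⊆ meetSet A z₀ ε₂ := fun _ ⟨z, hz, hzε⟩ =>
  ⟨z, hz, pseudospectrum_mono A h hzε⟩

/-- With `r` and `v` held fixed, a strict residual bound survives small rotations of the ray. -/
lemma meetSet_mem_nhds (A : Matrix (Fin m) (Fin m) ℂ) (z₀ : ℂ) {ε r θ : ℝ} (hr : 0 < r)
    {v : EuclideanSpace ℂ (Fin m)} (hv : ‖v‖ = 1) (h : ‖op (rayShift A z₀ r θ) v‖ < ε) :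
    meetSet A z₀ ε ∈ 𝓝 θ := by
  have hcont : Continuous fun t : ℝ => ‖op (rayShift A z₀ r t) v‖ := by
    simp only [rayShift_apply]
    fun_prop
  filter_upwards [hcont.continuousAt.eventually_lt continuousAt_const h] with t ht
  exact (mem_ray_inter_pseudospectrum_iff A z₀ ε t).2 ⟨r, hr, v, hv, ht.le⟩

lemma spectrum_subset_pseudospectrum (A : Matrix (Fin m) (Fin m) ℂ) {ε : ℝ} (hε : 0 ≤ ε) :
    spectrum ℂ A ⊆ pseudospectrum ε A := fun z hz => ⟨0, by simpa using hε, by simpa using hz⟩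

lemma spectrum_nonempty (hm : 0 < m) (A : Matrix (Fin m) (Fin m) ℂ) : (spectrum ℂ A).Nonempty := by
  have : Nonempty (Fin m) := ⟨⟨0, hm⟩⟩
  exact spectrum.nonempty_of_isAlgClosed_of_finiteDimensional ℂ A

lemma exists_unit_eigenvector {A : Matrix (Fin m) (Fin m) ℂ} {z : ℂ} (hz : z ∈ spectrum ℂ A) :
    ∃ v : EuclideanSpace ℂ (Fin m), ‖v‖ = 1 ∧ op A v = z • v := by
  obtain ⟨v, hv, h⟩ := (mem_pseudospectrum_iff A z).1 (spectrum_subset_pseudospectrum A le_rfl hz)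
  exact ⟨v, hv, sub_eq_zero.1 (norm_le_zero_iff.1 h)⟩

lemma mem_ray_arg {z₀ z : ℂ} (h : z ≠ z₀) : z ∈ ray z₀ (z - z₀).arg := by
  refine ⟨‖z - z₀‖, norm_pos_iff.2 (sub_ne_zero.2 h), ?_⟩
  rw [mul_comm Complex.I, Complex.norm_mul_exp_arg_mul_I]
  ring

lemma finite_spectrum (A : Matrix (Fin m) (Fin m) ℂ) : (spectrum ℂ A).Finite :=
  (A.charpoly.finite_setOfPred_isRoot (Matrix.charpoly_monic _).ne_zero).subset
    fun _ hl => Matrix.mem_spectrum_iff_isRoot_charpoly.1 hl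

lemma arg_sub_of_mem_ray {z₀ z : ℂ} {θ : ℝ} (hθ : θ ∈ Set.Ioc (-Real.pi) Real.pi)
    (h : z ∈ ray z₀ θ) : (z - z₀).arg = θ := by
  obtain ⟨r, hr, rfl⟩ := h
  have : z₀ + r * Complex.exp (Complex.I * θ) - z₀ =
      r * (Complex.cos θ + Complex.sin θ * Complex.I) := by
    rw [mul_comm Complex.I, Complex.exp_mul_I]; ring
  rw [this]
  exact Complex.arg_mul_cos_add_sin_mul_I hr hθ

lemma meetSet_nonempty (hm : 0 < m) (A : Matrix (Fin m) (Fin m) ℂ) (z₀ : ℂ) {ε : ℝ}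
    (hε : 0 ≤ ε) (h : ε ∉ singularValueSet (A - z₀ • (1 : Matrix (Fin m) (Fin m) ℂ))) :
    (meetSet A z₀ ε).Nonempty := by
  obtain ⟨z, hz⟩ := spectrum_nonempty hm A
  have hz' := spectrum_subset_pseudospectrum A hε hz
  by_cases hzz : z = z₀
  · exact ⟨0, ray_inter_nonempty_of_mem A z₀ hε h (hzz ▸ hz') 0⟩
  · exact ⟨_, z, mem_ray_arg hzz, hz'⟩

lemma exists_meetSet_mem_nhds (hm : 0 < m) (A : Matrix (Fin m) (Fin m) ℂ) (z₀ : ℂ) {ε : ℝ}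
    (hε : 0 < ε) : ∃ θ, meetSet A z₀ ε ∈ 𝓝 θ := by
  obtain ⟨z, hz⟩ := spectrum_nonempty hm A
  obtain ⟨v, hv, h⟩ := exists_unit_eigenvector hz
  by_cases hzz : z = z₀
  -- If the eigenvalue is `z₀` itself, no ray contains it; moving away by `ε / 2` gives the residual
  -- `ε / 2 < ε`.
  · refine ⟨0, meetSet_mem_nhds A z₀ (half_pos hε) hv ?_⟩
    rw [rayShift_apply, h, hzz, ← sub_smul, norm_smul, hv]
    simp [abs_of_pos hε]
    linarith
  · obtain ⟨r, hr, hzr⟩ := mem_ray_arg hzz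
    refine ⟨(z - z₀).arg, meetSet_mem_nhds A z₀ hr hv ?_⟩
    rw [rayShift_apply, h, ← hzr, sub_self, norm_zero]
    exact hε

/-- A `2π`-periodic set that is a neighbourhood of some point has positive measure in one period. -/
lemma volume_pos_of_periodic {T : Set ℝ} (hT : Function.Periodic (· ∈ T) (2 * Real.pi)) {x : ℝ}
    (hx : T ∈ 𝓝 x) : 0 < volume (Set.Ioc (-Real.pi) Real.pi ∩ T) := by
  by_contra! h0
  have h0 := le_antisymm h0 zero_le
  -- Countably many translates of one period cover `T`, so a null period would make `T` null.
  have hsub : T ⊆ ⋃ k : ℤ, (fun t => t + k • (2 * Real.pi)) ⁻¹'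
      (Set.Ioc (-Real.pi) Real.pi ∩ T) := by
    intro t ht
    obtain ⟨k, hk, -⟩ := existsUnique_add_zsmul_mem_Ioc Real.two_pi_pos t (-Real.pi)
    refine Set.mem_iUnion.2 ⟨k, ?_, ?_⟩
    · have : -Real.pi + 2 * Real.pi = Real.pi := by ring
      rwa [this] at hk
    · exact ((hT.zsmul k) t).symm ▸ ht
  have : volume T = 0 := measure_mono_null hsub (measure_iUnion_null fun k => by
    rw [measure_preimage_add_right, h0])
  exact (Measure.measure_pos_of_mem_nhds volume hx).ne' this

lemma volume_zeroSet_le (A : Matrix (Fin m) (Fin m) ℂ) (z₀ : ℂ) (ε : ℝ) :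
    volume (zeroSet A z₀ ε) ≤ ENNReal.ofReal (2 * Real.pi) := by
  have h2 : ENNReal.ofReal (2 * Real.pi) = volume (Set.Ioc (-Real.pi) Real.pi) := by
    rw [Real.volume_Ioc]; congr 1; ring
  rw [h2]
  exact measure_mono fun _ h => h.1

/-- For `ε = 0` only `Δ = 0` is allowed, so the angles are arguments of the finitely many numbers `z
- z₀` with `z` an eigenvalue. -/
lemma volume_zeroSet_eq_zero_of_zero (hm : 0 < m) (A : Matrix (Fin m) (Fin m) ℂ) (z₀ : ℂ)
    (h : (0 : ℝ) ∉ singularValueSet (A - z₀ • (1 : Matrix (Fin m) (Fin m) ℂ))) :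
    volume (zeroSet A z₀ 0) = 0 := by
  have hsub : zeroSet A z₀ 0 ⊆ (fun z => (z - z₀).arg) '' spectrum ℂ A := by
    rw [zeroSet_eq hm A z₀ le_rfl h]
    rintro θ ⟨hθ, z, hzray, Δ, hΔ, hz⟩
    have hΔ0 : Δ = 0 := by simpa using norm_le_zero_iff.1 hΔ
    exact ⟨z, by simpa [hΔ0] using hz, arg_sub_of_mem_ray hθ hzray⟩
  exact (((finite_spectrum A).image _).subset hsub).measure_zero _

lemma volume_zeroSet_pos (hm : 0 < m) (A : Matrix (Fin m) (Fin m) ℂ) (z₀ : ℂ) {ε : ℝ}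
    (hε : 0 < ε) (h : ε ∉ singularValueSet (A - z₀ • (1 : Matrix (Fin m) (Fin m) ℂ))) :
    0 < volume (zeroSet A z₀ ε) := by
  obtain ⟨θ, hθ⟩ := exists_meetSet_mem_nhds hm A z₀ hε
  rw [zeroSet_eq hm A z₀ hε.le h]
  exact volume_pos_of_periodic (periodic_mem_meetSet A z₀ ε) hθ

lemma volume_zeroSet_eq_two_pi (hm : 0 < m) (A : Matrix (Fin m) (Fin m) ℂ) (z₀ : ℂ) {ε : ℝ}
    (hε : 0 ≤ ε) (h : ε ∉ singularValueSet (A - z₀ • (1 : Matrix (Fin m) (Fin m) ℂ)))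
    (hlt : ∃ θ : ℝ, rayFun A z₀ 0 θ < ε) :
    volume (zeroSet A z₀ ε) = ENNReal.ofReal (2 * Real.pi) := by
  obtain ⟨θ, hlt⟩ := hlt
  rw [rayFun, rayShift_zero] at hlt
  obtain ⟨v, hv, hve⟩ := exists_unit_norm_op_eq (sigmaMin_nonneg _)
    (sigmaMin_mem_singularValueSet hm (A - z₀ • (1 : Matrix (Fin m) (Fin m) ℂ)))
  rw [← hve, op_sub_smul_one_apply] at hlt
  have : meetSet A z₀ ε = Set.univ :=
    Set.eq_univ_of_forall fun t => ray_inter_nonempty_of_lt A z₀ hv hlt t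
  rw [zeroSet_eq hm A z₀ hε h, this, Set.inter_univ, Real.volume_Ioc]
  congr 1
  ring

lemma volume_zeroSet_mono (hm : 0 < m) (A : Matrix (Fin m) (Fin m) ℂ) (z₀ : ℂ) {ε₁ ε₂ : ℝ}
    (hε₁ : 0 ≤ ε₁) (hε₂ : 0 ≤ ε₂)
    (h₁ : ε₁ ∉ singularValueSet (A - z₀ • (1 : Matrix (Fin m) (Fin m) ℂ)))
    (h₂ : ε₂ ∉ singularValueSet (A - z₀ • (1 : Matrix (Fin m) (Fin m) ℂ))) (h : ε₁ ≤ ε₂) :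
    volume (zeroSet A z₀ ε₁) ≤ volume (zeroSet A z₀ ε₂) := by
  rw [zeroSet_eq hm A z₀ hε₁ h₁, zeroSet_eq hm A z₀ hε₂ h₂]
  exact measure_mono (Set.inter_subset_inter_right _ (meetSet_mono A z₀ h))

lemma volume_zeroSet_lt (hm : 0 < m) (A : Matrix (Fin m) (Fin m) ℂ) (z₀ : ℂ) {ε₁ ε₂ : ℝ}
    (hε₁ : 0 ≤ ε₁) (hε₂ : 0 ≤ ε₂)
    (h₁ : ε₁ ∉ singularValueSet (A - z₀ • (1 : Matrix (Fin m) (Fin m) ℂ)))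
    (h₂ : ε₂ ∉ singularValueSet (A - z₀ • (1 : Matrix (Fin m) (Fin m) ℂ)))
    (hray : ∃ θ : ℝ, ray z₀ θ ∩ pseudospectrum ε₁ A = ∅) (h : ε₁ < ε₂) :
    volume (zeroSet A z₀ ε₁) < volume (zeroSet A z₀ ε₂) := by
  have hfin : volume (zeroSet A z₀ ε₁) ≠ ⊤ :=
    ((volume_zeroSet_le A z₀ ε₁).trans_lt ENNReal.ofReal_lt_top).ne
  have hclosed := isClosed_meetSet hm A z₀ hε₁ h₁
  have hne : meetSet A z₀ ε₁ ≠ Set.univ := by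
    obtain ⟨θ, hθ⟩ := hray
    intro hu
    have : θ ∈ meetSet A z₀ ε₁ := hu ▸ Set.mem_univ θ
    exact (Set.nonempty_iff_ne_empty.1 this) hθ
  -- A boundary angle exists as `ℝ` is connected. It belongs to the closed set for `ε₁`, hence is
  -- interior for `ε₂`, while angles missed at level `ε₁` accumulate at it; so the difference of the
  -- two sets contains an open set.
  obtain ⟨θ, hθ⟩ := nonempty_frontier_iff.2 ⟨meetSet_nonempty hm A z₀ hε₁ h₁, hne⟩
  obtain ⟨r, hr, v, hv, hvε⟩ :=
    (mem_ray_inter_pseudospectrum_iff A z₀ ε₁ θ).1 (hclosed.frontier_subset hθ)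
  have hnhds : meetSet A z₀ ε₂ ∈ 𝓝 θ := meetSet_mem_nhds A z₀ hr hv (hvε.trans_lt h)
  have hcl : θ ∈ closure (meetSet A z₀ ε₁)ᶜ := by
    rw [frontier_eq_closure_inter_closure] at hθ
    exact hθ.2
  obtain ⟨x, hx₂, hx₁⟩ := mem_closure_iff_nhds.1 hcl _ (interior_mem_nhds.2 hnhds)
  have hT : meetSet A z₀ ε₂ \ meetSet A z₀ ε₁ ∈ 𝓝 x :=
    inter_mem (mem_interior_iff_mem_nhds.1 hx₂) (hclosed.isOpen_compl.mem_nhds hx₁)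
  have hper : Function.Periodic (· ∈ meetSet A z₀ ε₂ \ meetSet A z₀ ε₁) (2 * Real.pi) := by
    intro t
    have e₁ := periodic_mem_meetSet A z₀ ε₁ t
    have e₂ := periodic_mem_meetSet A z₀ ε₂ t
    simp only [eq_iff_iff] at e₁ e₂
    simp only [Set.mem_sdiff, e₁, e₂]
  have hpos := volume_pos_of_periodic hper hT
  have hmeas : MeasurableSet (zeroSet A z₀ ε₁) := by
    rw [zeroSet_eq hm A z₀ hε₁ h₁]
    exact measurableSet_Ioc.inter hclosed.measurableSet
  have hdisj : Disjoint (Set.Ioc (-Real.pi) Real.pi ∩ (meetSet A z₀ ε₂ \ meetSet A z₀ ε₁))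
      (zeroSet A z₀ ε₁) := by
    rw [zeroSet_eq hm A z₀ hε₁ h₁]
    exact Set.disjoint_left.2 fun t ht ht' => ht.2.2 ht'.2
  calc volume (zeroSet A z₀ ε₁)
      < volume (Set.Ioc (-Real.pi) Real.pi ∩ (meetSet A z₀ ε₂ \ meetSet A z₀ ε₁)) +
        volume (zeroSet A z₀ ε₁) := by
        rw [add_comm]
        exact ENNReal.lt_add_right hfin hpos.ne'
    _ = volume (Set.Ioc (-Real.pi) Real.pi ∩ (meetSet A z₀ ε₂ \ meetSet A z₀ ε₁) ∪
        zeroSet A z₀ ε₁) := (measure_union hdisj hmeas).symm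
    _ ≤ volume (zeroSet A z₀ ε₂) := by
        refine measure_mono ?_
        rw [zeroSet_eq hm A z₀ hε₁ h₁, zeroSet_eq hm A z₀ hε₂ h₂]
        rintro t (ht | ht)
        · exact ⟨ht.1, ht.2.1⟩
        · exact ⟨ht.1, meetSet_mono A z₀ h.le ht.2⟩

/-! ### Connected components -/

lemma isCompact_pseudospectrum (A : Matrix (Fin m) (Fin m) ℂ) (ε : ℝ) :
    IsCompact (pseudospectrum ε A) := by
  have hcont : Continuous fun p : ℂ × EuclideanSpace ℂ (Fin m) => ‖op A p.2 - p.1 • p.2‖ := by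
    fun_prop
  have hK : IsCompact ((Metric.closedBall (0 : ℂ) (‖op A‖ + ε) ×ˢ
      Metric.sphere (0 : EuclideanSpace ℂ (Fin m)) 1) ∩ {p | ‖op A p.2 - p.1 • p.2‖ ≤ ε}) :=
    ((isCompact_closedBall _ _).prod (isCompact_sphere _ _)).inter_right
      (isClosed_le hcont continuous_const)
  convert hK.image continuous_fst
  ext z
  rw [mem_pseudospectrum_iff]
  constructor
  · rintro ⟨v, hv, h⟩
    refine ⟨(z, v), ⟨⟨?_, by simpa using hv⟩, h⟩, rfl⟩
    rw [mem_closedBall_zero_iff]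
    calc ‖z‖ = ‖op A v - (op A v - z • v)‖ := by rw [sub_sub_cancel, norm_smul, hv, mul_one]
      _ ≤ ‖op A v‖ + ‖op A v - z • v‖ := norm_sub_le _ _
      _ ≤ ‖op A‖ + ε := add_le_add (by simpa [hv] using (op A).le_opNorm v) h
  · rintro ⟨⟨w, v⟩, ⟨⟨-, hv⟩, h⟩, rfl⟩
    exact ⟨v, by simpa using hv, h⟩

lemma spectrum_op (A : Matrix (Fin m) (Fin m) ℂ) : spectrum ℂ (op A) = spectrum ℂ A :=
  AlgEquiv.spectrum_eq (Matrix.toEuclideanCLM (n := Fin m) (𝕜 := ℂ)).toAlgEquiv A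

/-- A relatively clopen part of the pseudospectrum without eigenvalues is empty: this is the
maximum principle for the resolvent. -/
lemma eq_empty_of_disjoint_spectrum (A : Matrix (Fin m) (Fin m) ℂ) {ε : ℝ} (hε : 0 ≤ ε)
    {K K' : Set ℂ} (hK : IsCompact K) (hK' : IsCompact K') (hdisj : Disjoint K K')
    (hunion : pseudospectrum ε A = K ∪ K') (hspec : Disjoint K (spectrum ℂ A)) : K = ∅ := by
  by_contra hne
  obtain ⟨z₁, hz₁⟩ := Set.nonempty_iff_ne_empty.2 hne
  obtain ⟨v, hv, hvε⟩ := (mem_pseudospectrum_iff A z₁).1 (by rw [hunion]; exact Or.inl hz₁)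
  -- The maximum principle is applied to `z ↦ (z - A)⁻¹ u` for this fixed `u`, of norm at most `ε`;
  -- its value at `z₁` is `-v`, of norm one.
  set u := op A v - z₁ • v with hu
  obtain ⟨δ, hδ, hthick⟩ := hdisj.exists_cthickenings hK hK'.isClosed
  set U := Metric.thickening δ K with hU
  have hKU : K ⊆ U := Metric.self_subset_thickening hδ K
  have hclos : ∀ z ∈ closure U, z ∈ pseudospectrum ε A → z ∈ K := by
    intro z hz hzε
    rw [hunion] at hzε
    refine hzε.resolve_right fun hzK' => ?_
    exact Set.disjoint_left.1 hthick (Metric.closure_thickening_subset_cthickening δ K hz)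
      (Metric.self_subset_cthickening K' hzK')
  have hres : ∀ z ∈ closure U, z ∈ resolventSet ℂ (op A) := by
    intro z hz
    by_contra hzs
    have hzs' : z ∈ spectrum ℂ A := spectrum_op A ▸ hzs
    exact Set.disjoint_left.1 hspec
      (hclos z hz (spectrum_subset_pseudospectrum A hε hzs')) hzs'
  have hleft : ∀ z ∈ closure U, ∀ w, resolvent (op A) z (z • w - op A w) = w := by
    intro z hz w
    have := congrArg (fun f => f w) (Ring.inverse_mul_cancel _ (hres z hz))
    simpa [resolvent, Algebra.algebraMap_eq_smul_one] using this
  have hright : ∀ z ∈ closure U, z • resolvent (op A) z u - op A (resolvent (op A) z u) = u := by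
    intro z hz
    have := congrArg (fun f => f u) (Ring.mul_inverse_cancel _ (hres z hz))
    simpa [resolvent, Algebra.algebraMap_eq_smul_one] using this
  have hdiff : DiffContOnCl ℂ (fun z => resolvent (op A) z u) U := by
    refine DifferentiableOn.diffContOnCl fun z hz => ?_
    have h1 := (spectrum.hasDerivAt_resolvent_const_left (hres z hz)).differentiableAt
    exact (h1.clm_apply (differentiableAt_const u)).differentiableWithinAt
  have hbdd : Bornology.IsBounded U := hK.isBounded.thickening
  obtain ⟨z, hz, hmax⟩ := Complex.exists_mem_frontier_isMaxOn_norm hbdd ⟨z₁, hKU hz₁⟩ hdiff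
  have hz₁U : z₁ ∈ closure U := subset_closure (hKU hz₁)
  have hval : ‖resolvent (op A) z₁ u‖ = 1 := by
    have : resolvent (op A) z₁ u = -v := by
      rw [← hleft z₁ hz₁U (-v), hu]
      congr 1
      rw [map_neg, smul_neg]
      abel
    rw [this, norm_neg, hv]
  have hone : 1 ≤ ‖resolvent (op A) z u‖ := hval ▸ hmax hz₁U
  have hzU : z ∈ closure U := frontier_subset_closure hz
  have hzK : z ∉ K := fun h => by
    rw [Metric.isOpen_thickening.frontier_eq] at hz
    exact hz.2 (hKU h)
  -- At the frontier maximum `w = (z - A)⁻¹ u` has norm at least one, so normalising it leaves a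
  -- residual of at most `‖u‖ ≤ ε`. Thus `z` would lie in `K`, although the frontier of the open set
  -- `U ⊇ K` misses `K`.
  refine hzK (hclos z hzU ((mem_pseudospectrum_iff A z).2 ?_))
  set w := resolvent (op A) z u with hw
  have hw0 : ‖w‖ ≠ 0 := by linarith
  refine ⟨((‖w‖⁻¹ : ℝ) : ℂ) • w, ?_, ?_⟩
  · rw [norm_smul, Complex.norm_real, norm_inv, norm_norm, inv_mul_cancel₀ hw0]
  · rw [map_smul, smul_comm z, ← smul_sub, ← norm_neg, ← smul_neg, neg_sub, hright z hzU,
      norm_smul, Complex.norm_real, norm_inv, norm_norm]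
    exact (mul_le_of_le_one_left (norm_nonneg _) (inv_le_one_of_one_le₀ hone)).trans hvε

lemma ENat_card_le_of_surjective {α β : Type*} {f : α → β} (hf : Function.Surjective f) :
    ENat.card β ≤ ENat.card α :=
  ENat.card_le_card_of_injective (Function.injective_surjInv hf)

lemma encard_spectrum_le (A : Matrix (Fin m) (Fin m) ℂ) : (spectrum ℂ A).encard ≤ m := by
  have hsub : spectrum ℂ A ⊆ (A.charpoly.roots.toFinset : Set ℂ) := by
    intro l hl
    rw [Finset.mem_coe, Multiset.mem_toFinset,
      Polynomial.mem_roots (Matrix.charpoly_monic A).ne_zero]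
    exact Matrix.mem_spectrum_iff_isRoot_charpoly.1 hl
  refine (Set.encard_le_encard hsub).trans ?_
  rw [Set.encard_coe_eq_coe_finsetCard]
  have h1 : A.charpoly.roots.toFinset.card ≤ m := by
    refine (Multiset.toFinset_card_le _).trans ((Polynomial.card_roots' _).trans ?_)
    rw [Matrix.charpoly_natDegree_eq_dim, Fintype.card_fin]
  exact_mod_cast h1

/-- Every component of the pseudospectrum contains an eigenvalue. -/
lemma surjective_spectrum_to_components (A : Matrix (Fin m) (Fin m) ℂ) {ε : ℝ} (hε : 0 ≤ ε) :
    Function.Surjective fun z : spectrum ℂ A => ConnectedComponents.mk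
      (⟨z.1, spectrum_subset_pseudospectrum A hε z.2⟩ : pseudospectrum ε A) := by
  intro c
  obtain ⟨z₁, rfl⟩ := ConnectedComponents.surjective_coe c
  by_contra! hne
  have : CompactSpace (pseudospectrum ε A) :=
    isCompact_iff_compactSpace.1 (isCompact_pseudospectrum A ε)
  -- In a compact Hausdorff space a component is the intersection of the clopen sets around it.
  -- Separating each of the finitely many eigenvalues from `z₁` and intersecting gives a clopen set
  -- free of eigenvalues.
  have hclopen : ∀ e : spectrum ℂ A, ∃ s : Set (pseudospectrum ε A), IsClopen s ∧ z₁ ∈ s ∧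
      (⟨e.1, spectrum_subset_pseudospectrum A hε e.2⟩ : pseudospectrum ε A) ∉ s := by
    intro e
    have h1 : (⟨e.1, spectrum_subset_pseudospectrum A hε e.2⟩ : pseudospectrum ε A) ∉
        connectedComponent z₁ := fun h => hne e (ConnectedComponents.coe_eq_coe'.2 h)
    rw [connectedComponent_eq_iInter_isClopen, Set.mem_iInter] at h1
    push Not at h1
    obtain ⟨⟨s, hs, hz⟩, hes⟩ := h1
    exact ⟨s, hs, hz, hes⟩
  choose s hs hz hes using hclopen
  have : Finite (spectrum ℂ A) := (finite_spectrum A).to_subtype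
  have hS : IsClopen (⋂ e, s e) := isClopen_iInter_of_finite hs
  set S := ⋂ e, s e with hSdef
  have hempty := eq_empty_of_disjoint_spectrum A hε (K := Subtype.val '' S)
    (K' := Subtype.val '' Sᶜ) (hS.isClosed.isCompact.image continuous_subtype_val)
    (hS.compl.isClosed.isCompact.image continuous_subtype_val)
    (Set.disjoint_image_of_injective Subtype.val_injective disjoint_compl_right)
    (by rw [← Set.image_union, Set.union_compl_self, Set.image_univ, Subtype.range_coe])
    (Set.disjoint_left.2 (by
      rintro _ ⟨x, hx, rfl⟩ hxs
      exact hes ⟨x, hxs⟩ (Set.mem_iInter.1 hx ⟨x, hxs⟩)))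
  have : (z₁ : ℂ) ∈ Subtype.val '' S := ⟨z₁, Set.mem_iInter.2 hz, rfl⟩
  rw [hempty] at this
  exact this

lemma card_components_pseudospectrum_le (A : Matrix (Fin m) (Fin m) ℂ) {ε : ℝ} (hε : 0 ≤ ε) :
    ENat.card (ConnectedComponents (pseudospectrum ε A)) ≤ m := by
  refine (ENat_card_le_of_surjective (surjective_spectrum_to_components A hε)).trans ?_
  rw [ENat.card_coe_set_eq]
  exact encard_spectrum_le A

lemma card_components_le_of_continuous_surjective {α β : Type*} [TopologicalSpace α]
    [TopologicalSpace β] {f : α → β} (hf : Continuous f) (hs : Function.Surjective f) :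
    ENat.card (ConnectedComponents β) ≤ ENat.card (ConnectedComponents α) :=
  ENat_card_le_of_surjective (hf.connectedComponentsMap_surjective hs)

lemma arg_mem_zeroSet (hm : 0 < m) (A : Matrix (Fin m) (Fin m) ℂ) (z₀ : ℂ) {ε : ℝ}
    (hε : 0 ≤ ε) (h : ε ∉ singularValueSet (A - z₀ • (1 : Matrix (Fin m) (Fin m) ℂ)))
    (hz₀ : z₀ ∉ pseudospectrum ε A) (z : pseudospectrum ε A) :
    (z.1 - z₀).arg ∈ zeroSet A z₀ ε := by
  rw [zeroSet_eq hm A z₀ hε h]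
  exact ⟨Complex.arg_mem_Ioc _, z.1, mem_ray_arg fun hz => hz₀ (hz ▸ z.2), z.2⟩

lemma surjective_arg (hm : 0 < m) (A : Matrix (Fin m) (Fin m) ℂ) (z₀ : ℂ) {ε : ℝ}
    (hε : 0 ≤ ε) (h : ε ∉ singularValueSet (A - z₀ • (1 : Matrix (Fin m) (Fin m) ℂ)))
    {θ : ℝ} (hθ : θ ∈ zeroSet A z₀ ε) : ∃ z : pseudospectrum ε A, (z.1 - z₀).arg = θ := by
  rw [zeroSet_eq hm A z₀ hε h] at hθ
  obtain ⟨hθ, z, hzray, hz⟩ := hθ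
  exact ⟨⟨z, hz⟩, arg_sub_of_mem_ray hθ hzray⟩

lemma zeroSet_eq_Ioc (hm : 0 < m) (A : Matrix (Fin m) (Fin m) ℂ) (z₀ : ℂ) {ε : ℝ}
    (hε : 0 ≤ ε) (h : ε ∉ singularValueSet (A - z₀ • (1 : Matrix (Fin m) (Fin m) ℂ)))
    (hz₀ : z₀ ∈ pseudospectrum ε A) : zeroSet A z₀ ε = Set.Ioc (-Real.pi) Real.pi := by
  rw [zeroSet_eq hm A z₀ hε h]
  exact Set.inter_eq_left.2 fun θ _ => ray_inter_nonempty_of_mem A z₀ hε h hz₀ θ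

/-- The angles of the rays that meet the pseudospectrum form at most `m` components modulo `2π`. -/
lemma card_components_zeroAngles_le (hm : 0 < m) (A : Matrix (Fin m) (Fin m) ℂ) (z₀ : ℂ) {ε : ℝ}
    (hε : 0 ≤ ε) (h : ε ∉ singularValueSet (A - z₀ • (1 : Matrix (Fin m) (Fin m) ℂ))) :
    ENat.card (ConnectedComponents (zeroAngles A z₀ ε)) ≤ m := by
  by_cases hz₀ : z₀ ∈ pseudospectrum ε A
  · have h1 : IsPreconnected (zeroAngles A z₀ ε) := by
      rw [zeroAngles, zeroSet_eq_Ioc hm A z₀ hε h hz₀]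
      exact isPreconnected_Ioc.image _ Real.Angle.continuous_coe.continuousOn
    have : PreconnectedSpace (zeroAngles A z₀ ε) := isPreconnected_iff_preconnectedSpace.1 h1
    have h2 : ENat.card (ConnectedComponents (zeroAngles A z₀ ε)) ≤ 1 :=
      (ENat.card_le_one_iff_subsingleton _).2 inferInstance
    exact h2.trans (by exact_mod_cast hm)
  -- Modulo `2π` the argument is continuous away from `0`, and `z - z₀` never vanishes here.
  · let f : pseudospectrum ε A → zeroAngles A z₀ ε := fun z =>
      ⟨((z.1 - z₀).arg : Real.Angle), _, arg_mem_zeroSet hm A z₀ hε h hz₀ z, rfl⟩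
    have hf : Continuous f := by
      refine Continuous.subtype_mk (continuous_iff_continuousAt.2 fun z => ?_) _
      have hne : z.1 - z₀ ≠ 0 := sub_ne_zero.2 fun hz => hz₀ (hz ▸ z.2)
      have hc : ContinuousAt (fun z : pseudospectrum ε A => z.1 - z₀) z := by fun_prop
      exact ContinuousAt.comp (f := fun z : pseudospectrum ε A => z.1 - z₀)
        (Complex.continuousAt_arg_coe_angle hne) hc
    have hs : Function.Surjective f := by
      rintro ⟨_, θ, hθ, rfl⟩
      obtain ⟨z, hz⟩ := surjective_arg hm A z₀ hε h hθ
      exact ⟨z, Subtype.ext (congrArg Real.Angle.coe hz)⟩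
    exact (card_components_le_of_continuous_surjective hf hs).trans
      (card_components_pseudospectrum_le A hε)

/-- Excluding the angle `π` keeps `Λ_ε(A) - z₀` away from the branch cut, so the real-valued `Arg`
is continuous on it. -/
lemma card_components_zeroSet_le (hm : 0 < m) (A : Matrix (Fin m) (Fin m) ℂ) (z₀ : ℂ) {ε : ℝ}
    (hε : 0 ≤ ε) (h : ε ∉ singularValueSet (A - z₀ • (1 : Matrix (Fin m) (Fin m) ℂ)))
    (hpi : Real.pi ∉ zeroSet A z₀ ε) :
    ENat.card (ConnectedComponents (zeroSet A z₀ ε)) ≤ m := by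
  have hz₀ : z₀ ∉ pseudospectrum ε A := by
    intro hz₀
    rw [zeroSet_eq_Ioc hm A z₀ hε h hz₀] at hpi
    exact hpi ⟨by linarith [Real.pi_pos], le_rfl⟩
  let f : pseudospectrum ε A → zeroSet A z₀ ε := fun z =>
    ⟨(z.1 - z₀).arg, arg_mem_zeroSet hm A z₀ hε h hz₀ z⟩
  have hf : Continuous f := by
    refine Continuous.subtype_mk (continuous_iff_continuousAt.2 fun z => ?_) _
    have hne : z.1 - z₀ ≠ 0 := sub_ne_zero.2 fun hz => hz₀ (hz ▸ z.2)
    have harg : (z.1 - z₀).arg ≠ Real.pi := fun hz =>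
      hpi (hz ▸ arg_mem_zeroSet hm A z₀ hε h hz₀ z)
    have hc : ContinuousAt (fun z : pseudospectrum ε A => z.1 - z₀) z := by fun_prop
    exact ContinuousAt.comp (f := fun z : pseudospectrum ε A => z.1 - z₀)
      (Complex.continuousAt_arg (Complex.mem_slitPlane_iff_arg.2 ⟨harg, hne⟩)) hc
  have hs : Function.Surjective f := by
    rintro ⟨θ, hθ⟩
    obtain ⟨z, hz⟩ := surjective_arg hm A z₀ hε h hθ
    exact ⟨z, Subtype.ext hz⟩
  exact (card_components_le_of_continuous_surjective hf hs).trans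
    (card_components_pseudospectrum_le A hε)

end SepLambda

end

theorem mainTheorem4 {m : ℕ} (hm : 0 < m) (A : Matrix (Fin m) (Fin m) ℂ) (z₀ : ℂ) :
    (∀ ε : ℝ, 0 ≤ ε →
      ε ∉ SepLambda.singularValueSet (A - z₀ • (1 : Matrix (Fin m) (Fin m) ℂ)) →
      -- the minimum defining `a_ε(θ)` is taken over nonzero numbers and is attained
      (∀ θ : ℝ,
        0 ∉ SepLambda.pencilSpectrum (SepLambda.matC A z₀ ε) (SepLambda.matD m θ) ∧
        IsLeast (SepLambda.sqArg '' SepLambda.leftEigenvalues A z₀ ε θ)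
          (SepLambda.aFun A z₀ ε θ)) ∧
      -- (i)
      (∀ θ : ℝ, 0 ≤ SepLambda.aFun A z₀ ε θ) ∧
      -- (ii)
      (∀ θ : ℝ,
        (SepLambda.aFun A z₀ ε θ = 0 ↔
          ∃ r : ℝ, 0 < r ∧ Complex.I * (r : ℂ) ∈
            SepLambda.pencilSpectrum (SepLambda.matC A z₀ ε) (SepLambda.matD m θ)) ∧
        ((∃ r : ℝ, 0 < r ∧ Complex.I * (r : ℂ) ∈
            SepLambda.pencilSpectrum (SepLambda.matC A z₀ ε) (SepLambda.matD m θ)) ↔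
          (SepLambda.ray z₀ θ ∩ SepLambda.pseudospectrum ε A).Nonempty)) ∧
      -- (iii)
      Continuous (fun θ : ℝ => SepLambda.aFun A z₀ ε θ) ∧
      -- (iv)
      (∀ (θ : ℝ) (l : ℂ), l ∈ SepLambda.leftEigenvalues A z₀ ε θ →
        SepLambda.sqArg l = SepLambda.aFun A z₀ ε θ →
        (∀ l' ∈ SepLambda.leftEigenvalues A z₀ ε θ,
          SepLambda.sqArg l' = SepLambda.aFun A z₀ ε θ → l' = l) →
        SepLambda.IsSimplePencilEigenvalue (SepLambda.matC A z₀ ε) (SepLambda.matD m θ) l →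
        DifferentiableAt ℝ (fun t : ℝ => SepLambda.aFun A z₀ ε t) θ) ∧
      -- (v)
      (ε = 0 ↔ MeasureTheory.volume (SepLambda.zeroSet A z₀ ε) = 0) ∧
      -- (vii)
      ((∃ θ : ℝ, SepLambda.rayFun A z₀ 0 θ < ε) →
        MeasureTheory.volume (SepLambda.zeroSet A z₀ ε) = ENNReal.ofReal (2 * Real.pi)) ∧
      -- (viii)
      ENat.card (ConnectedComponents (SepLambda.zeroAngles A z₀ ε)) ≤ (m : ℕ∞) ∧
      (Real.pi ∉ SepLambda.zeroSet A z₀ ε →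
        ENat.card (ConnectedComponents (SepLambda.zeroSet A z₀ ε)) ≤ (m : ℕ∞))) ∧
    -- (vi)
    (∀ ε₁ ε₂ : ℝ, 0 ≤ ε₁ → 0 ≤ ε₂ →
      ε₁ ∉ SepLambda.singularValueSet (A - z₀ • (1 : Matrix (Fin m) (Fin m) ℂ)) →
      ε₂ ∉ SepLambda.singularValueSet (A - z₀ • (1 : Matrix (Fin m) (Fin m) ℂ)) →
      (ε₁ ≤ ε₂ → MeasureTheory.volume (SepLambda.zeroSet A z₀ ε₁) ≤
        MeasureTheory.volume (SepLambda.zeroSet A z₀ ε₂)) ∧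
      ((∃ θ : ℝ, SepLambda.ray z₀ θ ∩ SepLambda.pseudospectrum ε₁ A = ∅) →
        (ε₁ < ε₂ ↔ MeasureTheory.volume (SepLambda.zeroSet A z₀ ε₁) <
          MeasureTheory.volume (SepLambda.zeroSet A z₀ ε₂)))) := by
  refine ⟨fun ε hε h => ?_, fun ε₁ ε₂ hε₁ hε₂ h₁ h₂ => ⟨fun hle => ?_, fun hray => ⟨fun hlt => ?_,
    fun hlt => ?_⟩⟩⟩
  · have h0 := SepLambda.zero_notMem_pencilSpectrum A z₀ hε h
    refine ⟨fun θ => ⟨h0 θ, SepLambda.isLeast_aFun hm A z₀ ε θ⟩,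
      SepLambda.aFun_nonneg A z₀ ε,
      fun θ => ⟨SepLambda.aFun_eq_zero_iff hm A z₀ θ (h0 θ),
        SepLambda.exists_pencil_iff_ray A z₀ hε θ⟩,
      SepLambda.continuous_aFun hm A z₀ h0,
      fun θ l hl _ huniq hs => SepLambda.differentiableAt_aFun hm A z₀ h0 hl huniq hs,
      ⟨fun hz => ?_, fun hv => ?_⟩,
      SepLambda.volume_zeroSet_eq_two_pi hm A z₀ hε h,
      SepLambda.card_components_zeroAngles_le hm A z₀ hε h,
      SepLambda.card_components_zeroSet_le hm A z₀ hε h⟩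
    · subst hz
      exact SepLambda.volume_zeroSet_eq_zero_of_zero hm A z₀ h
    · by_contra hne
      exact (SepLambda.volume_zeroSet_pos hm A z₀ (lt_of_le_of_ne hε (Ne.symm hne)) h).ne' hv
  · exact SepLambda.volume_zeroSet_mono hm A z₀ hε₁ hε₂ h₁ h₂ hle
  · exact SepLambda.volume_zeroSet_lt hm A z₀ hε₁ hε₂ h₁ h₂ hray hlt
  -- The converse is monotonicity with the roles of `ε₁` and `ε₂` exchanged.
  · by_contra! hle
    exact absurd hlt (not_lt.2 (SepLambda.volume_zeroSet_mono hm A z₀ hε₂ hε₁ h₂ h₁ hle))
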